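/- For $n\in\mathbb N$ and $p>0$ let $B_p^n=\{x\in\mathbb R^n:\ |x_1|^p+\dots+|x_n|^p\le 1\}$; for a $k$-dimensional linear subspace $E$ of $\mathbb R^n$ let $|\cdot|_k$ denote $k$-dimensional Lebesgue measure on $E$ (identified isometrically with $\mathbb R^k$). Put $$c(p)=\frac{e^{1-1/p}}{\Gamma(1+1/p)\,p^{1/p}} .$$ (i) Let $0<p<1$. Then $c(p)\in(0,1)$, and for all integers $1\le k\le n$ and every $k$-dimensional linear subspace $E\subseteq\mathbb R^n$, $$|B_p^n\cap E|_k^{1/k}\ \ge\ c(p)\,|B_p^n|_n^{1/n}.$$ (ii) $c(p)\sim e\sqrt{\dfrac{p}{2\pi}}$ as $p\to0^+$. (iii) For every $n\ge1$, the one-dimensional subspace $E_0=\mathrm{span}\{(1,\dots,1)\}\subseteq\mathbb R^n$ satisfies, for $0<p<1$, $$\frac{|B_p^n\cap E_0|_1}{|B_p^n|_n^{1/n}}=n^{\frac12-\frac1p}\,\frac{\Gamma(1+n/p)^{1/n}}{\Gamma(1+1/p)},$$ and, for fixed $n$ and $p\to0^+$, $$\frac{|B_p^n\cap E_0|_1}{|B_p^n|_n^{1/n}}\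 \sim\ \frac{p^{\frac12-\frac1{2n}}\;n^{\frac12+\frac1{2n}}}{(2\pi)^{\frac12-\frac1{2n}}}.$$ (iv) Consequently the order $p^{1/2}$ of the dimension-free constant $c(p)$ is optimal as a power of $p$: for every $a<\frac12$ and every $C>0$ there is $N$ such that for each fixed $n\ge N$, $|B_p^n\cap E_0|_1< C\,p^{a}\,|B_p^n|_n^{1/n}$ for all sufficiently small $p>0$. -/

import Mathlib

open MeasureTheory Filter Topology Asymptotics

noncomputable section

/-- The unit ball `B_p^n = {x ∈ ℝⁿ : |x₁|^p + ⋯ + |xₙ|^p ≤ 1}`. -/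
def lpBall (n : ℕ) (p : ℝ) : Set (EuclideanSpace ℝ (Fin n)) :=
  {x | ∑ i, |x i| ^ p ≤ 1}

/-- The volume `|A ∩ E|_k` of the section of `A ⊆ ℝⁿ` by a subspace `E` of dimension `k`: identify
`E` with `ℝ^k` by a linear isometry (coordinates in an orthonormal basis of `E`) and take
the `k`-dimensional Lebesgue measure of the image of `A ∩ E`. -/
def sectionVolume {n : ℕ} (E : Submodule ℝ (EuclideanSpace ℝ (Fin n)))
    (A : Set (EuclideanSpace ℝ (Fin n))) : ℝ :=
  (volume : Measure (EuclideanSpace ℝ (Fin (Module.finrank ℝ E)))).real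
    {y | (((stdOrthonormalBasis ℝ E).repr.symm y : E) : EuclideanSpace ℝ (Fin n)) ∈ A}

/-- The constant `e^{1 - 1/p} / (Γ(1 + 1/p) p^{1/p})`. -/
def sectionConst (p : ℝ) : ℝ :=
  Real.exp (1 - 1 / p) / (Real.Gamma (1 + 1 / p) * p ^ (1 / p))

/-- The diagonal `span {(1, …, 1)} ⊆ ℝⁿ`. -/
def diagonalLine (n : ℕ) : Submodule ℝ (EuclideanSpace ℝ (Fin n)) :=
  Submodule.span ℝ {WithLp.toLp 2 (fun _ : Fin n => (1 : ℝ))}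

/-- The ratio `|B_p^n ∩ E₀|_1 / |B_p^n|_n^{1/n}` for the diagonal line `E₀`. -/
def diagonalRatio (n : ℕ) (p : ℝ) : ℝ :=
  sectionVolume (diagonalLine n) (lpBall n p) / (volume.real (lpBall n p)) ^ (1 / (n : ℝ))

end

/-!
The lower bound for `p < 1` follows from the case `p = 1`, in which the constant is `1`: every
`k`-dimensional section of the cross-polytope satisfies `|B_1^n ∩ E|^{1/k} ≥ |B_1^n|^{1/n}`
(`le_sectionVolume_lpBall_one`). Indeed `n^{1 - 1/p} B_1^n ⊆ B_p^n` by the power mean inequality, and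
`|B_p^n| = (2 Γ(1 + 1/p))^n / Γ(1 + n/p)` (`volume_real_lpBall`), so the remaining comparison of
constants says that `Γ(1 + x) (e/x)^x` is not larger at `x = n` than at `x = n/p`. This function is
strictly increasing (`strictMonoOn_logNormGamma`), and since `c(p)` is `e` divided by its value at `1/p`,
the same monotonicity gives `c(p) < 1`.

For the cross-polytope two lower bounds are combined. If `2k < n`, the Euclidean ball of radius `n^{-1/2}`
inside `B_1^n` is large enough (`le_sectionVolume_lpBall_one_of_ball`). If `2k ≥ n`, then
`k! |B_1^n ∩ E| = ∫_E exp(-‖x‖₁) dx` is the value at `0` of the function that integrates `exp(-‖·‖₁)`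
over the translates of `E`. Its Fourier transform on `Eᗮ` is `∏ 2 / (1 + (2π ξᵢ)²)`, which by the
inequality of the arithmetic and geometric means is at least the radial function
`2^n (1 + (2π)² |ξ|² / n)^{-n}`, whose integral is explicit; Fourier inversion at `0` then bounds
the section from below (`le_sectionVolume_lpBall_one_of_fourier`). For the full-dimensional section and
for hyperplanes orthogonal to the diagonal this bound is an equality.

What is left are two inequalities between Gamma values in `n` and `k`. On a logarithmic scale both are
concave in `k` (regarded as a real variable), vanish at one end of the range, `k = 0` or `k = n`, and hence
need to be checked only at the other end, `k = (n - 1)/2` or `k = n/2`, where Stirling's formula with error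
bounds for real arguments decides, apart from a few exact values for `n ≤ 4`.

The asymptotic statements are Stirling's formula applied to explicit expressions: the diagonal line
meets `B_p^n` in a segment of length `2 n^{1/2 - 1/p}`.
-/

/-! ### Stirling's formula for the Gamma function -/

/-- The remainder `log Γ(x + 1) - ((x + 1/2) log x - x)` in Stirling's formula. -/
noncomputable def stirlingRemainder (x : ℝ) : ℝ :=
  Real.log (Real.Gamma (x + 1)) - (x + 1 / 2) * Real.log x + x

theorem Real.differentiableAt_log_Gamma {x : ℝ} (hx : 0 < x) :
    DifferentiableAt ℝ (fun y => Real.log (Real.Gamma y)) x :=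
  (Real.differentiableAt_Gamma fun m => by
    have : (0 : ℝ) ≤ m := m.cast_nonneg
    linarith).log (Real.Gamma_pos_of_pos hx).ne'

theorem Real.log_Gamma_add_one {x : ℝ} (hx : 0 < x) :
    Real.log (Real.Gamma (x + 1)) = Real.log x + Real.log (Real.Gamma x) := by
  rw [Real.Gamma_add_one hx.ne', Real.log_mul hx.ne' (Real.Gamma_pos_of_pos hx).ne']

theorem stirlingRemainder_sub_succ {x : ℝ} (hx : 0 < x) :
    stirlingRemainder x - stirlingRemainder (x + 1) =
      (x + 1 / 2) * Real.log (1 + 1 / x) - 1 := by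
  have h1 : (1 : ℝ) + 1 / x = (x + 1) / x := by field_simp
  rw [stirlingRemainder, stirlingRemainder, Real.log_Gamma_add_one (x := x + 1) (by linarith), h1,
    Real.log_div (by linarith) hx.ne']
  ring

theorem stirlingRemainder_succ_le {x : ℝ} (hx : 0 < x) :
    stirlingRemainder (x + 1) ≤ stirlingRemainder x := by
  have h := stirlingRemainder_sub_succ hx
  have h2 := Real.le_log_one_add_of_nonneg (x := 1 / x) (by positivity)
  have h3 : 1 ≤ (x + 1 / 2) * Real.log (1 + 1 / x) := by
    calc 1 = (x + 1 / 2) * (2 * (1 / x) / (1 / x + 2)) := by field_simp; ring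
      _ ≤ _ := by gcongr
  linarith

/-- The series of `log (1 + 1/x)` in powers of `1 / (2x + 1)` is compared with a geometric series; the
resulting bound telescopes. -/
theorem stirlingRemainder_sub_succ_le {x : ℝ} (hx : 0 < x) :
    stirlingRemainder x - stirlingRemainder (x + 1) ≤ 1 / (12 * x) - 1 / (12 * (x + 1)) := by
  have hy0 : 0 < 1 / (2 * x + 1) := by positivity
  have hy1 : 1 / (2 * x + 1) < 1 := by rw [div_lt_one (by linarith)]; linarith
  have hs := (Real.hasSum_log_one_add_inv hx).mul_left (x + 1 / 2)
  have hg : HasSum (fun k : ℕ => (1 / 3 : ℝ) * ((1 / (2 * x + 1)) ^ 2) ^ k + if k = 0 then 2 / 3 else 0)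
      ((1 / 3 : ℝ) * (1 - (1 / (2 * x + 1)) ^ 2)⁻¹ + 2 / 3) := by
    refine HasSum.add ((hasSum_geometric_of_lt_one (by positivity) ?_).mul_left _) ?_
    · exact pow_lt_one₀ hy0.le hy1 two_ne_zero
    · exact hasSum_ite_eq 0 (2 / 3 : ℝ)
  have hle := hasSum_le (fun k => ?_) hs hg
  · rw [stirlingRemainder_sub_succ hx]
    have : (1 / 3 : ℝ) * (1 - (1 / (2 * x + 1)) ^ 2)⁻¹ + 2 / 3 - 1 =
        1 / (12 * x) - 1 / (12 * (x + 1)) := by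
      have : (1 : ℝ) - (1 / (2 * x + 1)) ^ 2 = 4 * x * (x + 1) / (2 * x + 1) ^ 2 := by
        field_simp; ring
      rw [this]; field_simp; ring
    rw [← this]
    have h1 : (1 : ℝ) + 1 / x = 1 + x⁻¹ := by rw [one_div]
    rw [h1]
    linarith
  · have e : (x + 1 / 2) * (2 * (1 / (2 * (k : ℝ) + 1)) * (1 / (2 * x + 1)) ^ (2 * k + 1)) =
        (1 / (2 * (k : ℝ) + 1)) * ((1 / (2 * x + 1)) ^ 2) ^ k := by
      rw [pow_succ, pow_mul]; field_simp
    rw [e]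
    rcases Nat.eq_zero_or_pos k with rfl | hk
    · norm_num
    · rw [if_neg hk.ne', add_zero]
      have : (1 : ℝ) ≤ k := by exact_mod_cast hk
      gcongr
      linarith

/-- Along `x + ℕ` the remainder is compared with the one of the factorials, by the limit formula of
Bohr and Mollerup for `log Γ`. -/
theorem tendsto_stirlingRemainder_add_nat {x : ℝ} (hx : 0 < x) :
    Tendsto (fun n : ℕ => stirlingRemainder (x + n)) atTop (𝓝 (Real.log (2 * Real.pi) / 2)) := by
  have h1 : Tendsto (fun n : ℕ => Real.log (Real.Gamma (x + n + 1)) -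
      (x * Real.log n + Real.log n.factorial)) atTop (𝓝 0) := by
    have h := (Real.BohrMollerup.tendsto_log_gamma hx).const_sub (Real.log (Real.Gamma x))
    rw [sub_self] at h
    refine h.congr fun n => ?_
    have h2 := Real.BohrMollerup.f_add_nat_eq (f := Real.log ∘ Real.Gamma) (x := x)
      (fun {y} hy => by simp only [Function.comp]; rw [Real.log_Gamma_add_one hy]; ring) hx (n + 1)
    simp only [Function.comp, Nat.cast_add, Nat.cast_one, ← add_assoc] at h2
    rw [h2, Real.BohrMollerup.logGammaSeq]
    ring
  have h2 : Tendsto (fun n : ℕ => Real.log (Stirling.stirlingSeq n) + Real.log 2 / 2) atTop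
      (𝓝 (Real.log (2 * Real.pi) / 2)) := by
    have h := (Stirling.tendsto_stirlingSeq_sqrt_pi.log
      (Real.sqrt_pos.2 Real.pi_pos).ne').add_const (Real.log 2 / 2)
    convert h using 2
    rw [Real.log_mul two_ne_zero Real.pi_ne_zero, Real.log_sqrt Real.pi_nonneg]
    ring
  have h3 : Tendsto (fun n : ℕ => (n : ℝ) * Real.log (1 + x / n)) atTop (𝓝 x) :=
    (Real.tendsto_mul_log_one_add_div_atTop x).comp tendsto_natCast_atTop_atTop
  have h4 : Tendsto (fun n : ℕ => (x + 1 / 2) * Real.log (1 + x / n)) atTop (𝓝 0) := by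
    have : Tendsto (fun n : ℕ => 1 + x / n) atTop (𝓝 (1 + 0)) :=
      (tendsto_const_div_atTop_nhds_zero_nat x).const_add 1
    rw [add_zero] at this
    simpa using (this.log one_ne_zero).const_mul (x + 1 / 2)
  have h5 := ((h1.add h2).add ((h3.add h4).const_sub x))
  simp only [zero_add, add_zero, sub_self] at h5
  refine h5.congr' ?_
  filter_upwards [eventually_gt_atTop 0] with n hn
  have hn' : (0 : ℝ) < n := by exact_mod_cast hn
  have e1 : (1 : ℝ) + x / n = (x + n) / n := by field_simp; ring
  rw [stirlingRemainder, Stirling.log_stirlingSeq_formula, e1,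
    Real.log_div (by positivity) hn'.ne', Real.log_mul two_ne_zero hn'.ne',
    Real.log_div hn'.ne' (Real.exp_pos 1).ne', Real.log_exp]
  ring

/-- Stirling's formula with its lower error bound, for real arguments. -/
theorem le_stirlingRemainder {x : ℝ} (hx : 0 < x) :
    Real.log (2 * Real.pi) / 2 ≤ stirlingRemainder x := by
  have hanti : Antitone fun n : ℕ => stirlingRemainder (x + n) := antitone_nat_of_succ_le fun n => by
    have := stirlingRemainder_succ_le (x := x + n) (by positivity)
    push_cast
    rwa [← add_assoc]
  simpa using hanti.le_of_tendsto (tendsto_stirlingRemainder_add_nat hx) 0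

/-- Stirling's formula with its upper error bound, for real arguments. -/
theorem stirlingRemainder_le {x : ℝ} (hx : 0 < x) :
    stirlingRemainder x ≤ Real.log (2 * Real.pi) / 2 + 1 / (12 * x) := by
  have hmono : Monotone fun n : ℕ => stirlingRemainder (x + n) - 1 / (12 * (x + n)) :=
    monotone_nat_of_le_succ fun n => by
      have := stirlingRemainder_sub_succ_le (x := x + n) (by positivity)
      push_cast
      rw [← add_assoc]
      linarith
  have hlim : Tendsto (fun n : ℕ => stirlingRemainder (x + n) - 1 / (12 * (x + n))) atTop
      (𝓝 (Real.log (2 * Real.pi) / 2 - 0)) := by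
    refine (tendsto_stirlingRemainder_add_nat hx).sub ?_
    refine tendsto_const_nhds.div_atTop ?_
    exact Tendsto.const_mul_atTop (by norm_num)
      (tendsto_atTop_add_const_left _ _ tendsto_natCast_atTop_atTop)
  have := hmono.ge_of_tendsto hlim 0
  simp only [Nat.cast_zero, add_zero, sub_zero] at this
  linarith

theorem tendsto_stirlingRemainder :
    Tendsto stirlingRemainder atTop (𝓝 (Real.log (2 * Real.pi) / 2)) := by
  refine tendsto_of_tendsto_of_tendsto_of_le_of_le' tendsto_const_nhds
    (h := fun x => Real.log (2 * Real.pi) / 2 + 1 / (12 * x)) ?_ ?_ ?_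
  · have : Tendsto (fun x : ℝ => 1 / (12 * x)) atTop (𝓝 0) :=
      tendsto_const_nhds.div_atTop (Tendsto.const_mul_atTop (by norm_num) tendsto_id)
    simpa using this.const_add (Real.log (2 * Real.pi) / 2)
  · filter_upwards [eventually_gt_atTop 0] with x hx using le_stirlingRemainder hx
  · filter_upwards [eventually_gt_atTop 0] with x hx using stirlingRemainder_le hx

/-- The normalised Gamma function `Γ(1 + x) (e / x) ^ x`, on a logarithmic scale. -/
noncomputable def logNormGamma (x : ℝ) : ℝ :=
  Real.log (Real.Gamma (1 + x)) + x - x * Real.log x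

theorem logNormGamma_eq {x : ℝ} :
    logNormGamma x = stirlingRemainder x + Real.log x / 2 := by
  rw [logNormGamma, stirlingRemainder, add_comm 1 x]; ring

theorem logNormGamma_one : logNormGamma 1 = 1 := by
  have : (1 : ℝ) + 1 = 2 := by norm_num
  simp [logNormGamma, this]

/-- `log Γ` has slope larger than `log x` at `1 + x`: by convexity its slope at `2 + x` is
at least `log (1 + x)`, and the two slopes differ by `1 / (1 + x)`. -/
theorem log_lt_deriv_log_Gamma {x : ℝ} (hx : 0 < x) :
    Real.log x < deriv (fun y => Real.log (Real.Gamma y)) (1 + x) := by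
  have h1 : Real.log (1 + x) ≤ deriv (fun y => Real.log (Real.Gamma y)) (1 + x + 1) := by
    have h := Real.convexOn_log_Gamma.slope_le_deriv (x := 1 + x) (y := 1 + x + 1)
      (by simp; linarith) (by simp; linarith) (by linarith) (Real.differentiableAt_log_Gamma (by linarith))
    simp only [slope_def_field, Function.comp] at h
    rw [Real.log_Gamma_add_one (x := 1 + x) (by linarith)] at h
    have e : (Real.log (1 + x) + Real.log (Real.Gamma (1 + x)) - Real.log (Real.Gamma (1 + x))) /
      (1 + x + 1 - (1 + x)) = Real.log (1 + x) := by
        rw [show (1 + x + 1 - (1 + x)) = 1 by ring]; ring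
    rw [e] at h
    exact h
  have h2 : deriv (fun y => Real.log (Real.Gamma y)) (1 + x + 1) =
      1 / (1 + x) + deriv (fun y => Real.log (Real.Gamma y)) (1 + x) := by
    rw [← deriv_comp_add_const (f := fun y => Real.log (Real.Gamma y)) (a := 1)]
    have : (fun y : ℝ => Real.log (Real.Gamma (y + 1))) =ᶠ[𝓝 (1 + x)]
        fun y => Real.log y + Real.log (Real.Gamma y) := by
      filter_upwards [lt_mem_nhds (show (0 : ℝ) < 1 + x by linarith)] with y hy
      exact Real.log_Gamma_add_one hy
    rw [this.deriv_eq, deriv_fun_add (Real.differentiableAt_log (by linarith))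
      (Real.differentiableAt_log_Gamma (by linarith)),
      Real.deriv_log, one_div]
  have h3 : 1 / (1 + x) < Real.log (1 + x) - Real.log x := by
    have := Real.log_lt_sub_one_of_pos (x := x / (1 + x)) (by positivity)
      (by rw [Ne, div_eq_one_iff_eq (by linarith)]; linarith)
    rw [Real.log_div hx.ne' (by linarith)] at this
    have e : x / (1 + x) - 1 = - (1 / (1 + x)) := by field_simp; ring
    linarith
  linarith

theorem strictMonoOn_logNormGamma : StrictMonoOn logNormGamma (Set.Ioi 0) := by
  have hd : ∀ x : ℝ, 0 < x → HasDerivAt logNormGamma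
      (deriv (fun y => Real.log (Real.Gamma y)) (1 + x) - Real.log x) x := by
    intro x hx
    have hg : HasDerivAt (fun y => Real.log (Real.Gamma y))
        (deriv (fun y => Real.log (Real.Gamma y)) (1 + x)) (1 + x) :=
      (Real.differentiableAt_log_Gamma (by linarith)).hasDerivAt
    have h1 := (hg.comp_const_add 1 x).add (hasDerivAt_id x)
    have h2 := h1.sub (Real.hasDerivAt_mul_log hx.ne')
    have e : ∀ d : ℝ, d - Real.log x = d + 1 - (Real.log x + 1) := fun d => by ring
    rw [e]
    exact h2
  refine strictMonoOn_of_deriv_pos (convex_Ioi 0)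
    (fun x hx => (hd x hx).continuousAt.continuousWithinAt) fun x hx => ?_
  rw [interior_Ioi] at hx
  rw [(hd x hx).deriv]
  linarith [log_lt_deriv_log_Gamma hx]

theorem Gamma_one_add_eq_exp {x : ℝ} (hx : 0 < x) :
    Real.Gamma (1 + x) = Real.exp (logNormGamma x) * (x / Real.exp 1) ^ x := by
  rw [Real.rpow_def_of_pos (by positivity), ← Real.exp_add, Real.log_div hx.ne' (Real.exp_pos 1).ne',
    Real.log_exp, logNormGamma]
  have : Real.log (Real.Gamma (1 + x)) + x - x * Real.log x + (Real.log x - 1) * x =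
    Real.log (Real.Gamma (1 + x)) := by ring
  rw [this, Real.exp_log (Real.Gamma_pos_of_pos (by linarith))]

/-! ### Concavity of Gamma quotients -/

theorem ConcaveOn.comp_half_add {f : ℝ → ℝ} (hf : ConcaveOn ℝ (Set.Ioi 0) f) {c : ℝ} (hc : 0 < c) :
    ConcaveOn ℝ (Set.Ici 0) fun x => f (x / 2 + c) := by
  refine ⟨convex_Ici 0, fun x hx y hy a b ha hb hab => ?_⟩
  rw [Set.mem_Ici] at hx hy
  have h := hf.2 (x := x / 2 + c) (y := y / 2 + c) (by simp; positivity) (by simp; positivity)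
    ha hb hab
  have e : (a • x + b • y) / 2 + c = a • (x / 2 + c) + b • (y / 2 + c) := by
    simp only [smul_eq_mul]
    linear_combination (-c) * hab
  simp only [e]
  exact h

theorem concaveOn_neg_log_Gamma :
    ConcaveOn ℝ (Set.Ioi 0) fun x => -Real.log (Real.Gamma x) :=
  Real.convexOn_log_Gamma.neg

theorem concaveOn_log_Gamma_add_nat_sub (N : ℕ) :
    ConcaveOn ℝ (Set.Ioi 0) fun x => Real.log (Real.Gamma (x + N)) - Real.log (Real.Gamma x) := by
  induction N with
  | zero => simpa using concaveOn_const (0 : ℝ) (convex_Ioi (0 : ℝ))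
  | succ N ih =>
    have hlog : ConcaveOn ℝ (Set.Ioi 0) fun x : ℝ => Real.log (x + N) := by
      refine ⟨convex_Ioi 0, fun x hx y hy a b ha hb hab => ?_⟩
      rw [Set.mem_Ioi] at hx hy
      have h := strictConcaveOn_log_Ioi.concaveOn.2 (x := x + N) (y := y + N)
        (by simp; positivity) (by simp; positivity) ha hb hab
      have e : a • x + b • y + N = a • (x + N) + b • (y + N) := by
        simp only [smul_eq_mul]
        linear_combination (-(N : ℝ)) * hab
      simp only [e]
      exact h
    refine (hlog.add ih).congr fun x hx => ?_
    rw [Set.mem_Ioi] at hx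
    simp only [Pi.add_apply]
    push_cast
    rw [← add_assoc, Real.log_Gamma_add_one (x := x + N) (by positivity)]
    ring

theorem log_Gamma_add_one_duplication {x : ℝ} (hx : 0 ≤ x) :
    Real.log (Real.Gamma (x + 1)) = Real.log (Real.Gamma (x / 2 + 1 / 2)) +
      Real.log (Real.Gamma (x / 2 + 1)) + x * Real.log 2 - Real.log Real.pi / 2 := by
  have h := Real.Gamma_mul_Gamma_add_half (x / 2 + 1 / 2)
  have e1 : x / 2 + 1 / 2 + 1 / 2 = x / 2 + 1 := by ring
  have e2 : 2 * (x / 2 + 1 / 2) = x + 1 := by ring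
  have e3 : 1 - (x + 1) = -x := by ring
  rw [e1, e2, e3] at h
  have g1 := (Real.Gamma_pos_of_pos (show 0 < x / 2 + 1 / 2 by positivity)).ne'
  have g2 := (Real.Gamma_pos_of_pos (show 0 < x / 2 + 1 by positivity)).ne'
  have g3 := (Real.Gamma_pos_of_pos (show 0 < x + 1 by positivity)).ne'
  have h' := congrArg Real.log h
  rw [Real.log_mul g1 g2, Real.log_mul (by positivity) (by positivity), Real.log_mul g3 (by positivity),
    Real.log_rpow two_pos, Real.log_sqrt Real.pi_nonneg] at h'
  linarith

/-- The quotient `Γ((n + x) / 2) / Γ(x + 1)` is log-concave in `x`: by the duplication formula it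
is, up to an exponential factor, a product of linear factors divided by a Gamma function. -/
theorem concaveOn_log_Gamma_half_sub {n : ℕ} (hn : 1 ≤ n) :
    ConcaveOn ℝ (Set.Ici 0) fun x =>
      Real.log (Real.Gamma ((n + x) / 2)) - Real.log (Real.Gamma (x + 1)) := by
  have hlin : ConcaveOn ℝ (Set.Ici 0) fun x : ℝ => Real.log Real.pi / 2 - x * Real.log 2 := by
    refine ⟨convex_Ici 0, fun x _ y _ a b _ _ hab => le_of_eq ?_⟩
    simp only [smul_eq_mul]
    linear_combination (Real.log Real.pi / 2) * hab
  obtain ⟨N, hN | hN⟩ := Nat.even_or_odd' (n - 1)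
  · have hn' : (n : ℝ) = 2 * N + 1 := by
      have : n = 2 * N + 1 := by omega
      exact_mod_cast this
    refine ((((concaveOn_log_Gamma_add_nat_sub N).comp_half_add (c := 1 / 2) (by norm_num)).add
      (concaveOn_neg_log_Gamma.comp_half_add one_pos)).add hlin).congr fun x hx => ?_
    simp only [Pi.add_apply]
    rw [log_Gamma_add_one_duplication hx, hn']
    have : (2 * (N : ℝ) + 1 + x) / 2 = x / 2 + 1 / 2 + N := by ring
    rw [this]
    ring
  · have hn' : (n : ℝ) = 2 * N + 2 := by
      have : n = 2 * N + 2 := by omega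
      exact_mod_cast this
    refine ((((concaveOn_log_Gamma_add_nat_sub N).comp_half_add one_pos).add
      (concaveOn_neg_log_Gamma.comp_half_add (c := 1 / 2) (by norm_num))).add hlin).congr
      fun x hx => ?_
    simp only [Pi.add_apply]
    rw [log_Gamma_add_one_duplication hx, hn']
    have : (2 * (N : ℝ) + 2 + x) / 2 = x / 2 + 1 + N := by ring
    rw [this]
    ring

theorem ConcaveOn.nonneg_of_endpoints {s : Set ℝ} {f : ℝ → ℝ} (hf : ConcaveOn ℝ s f) {x y z : ℝ}
    (hx : x ∈ s) (hy : y ∈ s) (hfx : 0 ≤ f x) (hfy : 0 ≤ f y) (hxz : x ≤ z) (hzy : z ≤ y) :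
    0 ≤ f z :=
  (le_min hfx hfy).trans (hf.ge_on_segment hx hy (by
    rw [segment_eq_Icc (hxz.trans hzy)]; exact ⟨hxz, hzy⟩))

/-! ### Numerical bounds for logarithms -/

/-- Bounds from `2 ^ 19 < 3 ^ 12` and `3 ^ 17 < 2 ^ 27`. -/
theorem log_three_bounds : 1.0974 < Real.log 3 ∧ Real.log 3 < 1.1009 := by
  have h1 := Real.log_two_gt_d9
  have h2 := Real.log_two_lt_d9
  have h3 : Real.log ((2 : ℝ) ^ 19) ≤ Real.log ((3 : ℝ) ^ 12) := Real.log_le_log (by norm_num) (by norm_num)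
  have h4 : Real.log ((3 : ℝ) ^ 17) ≤ Real.log ((2 : ℝ) ^ 27) := Real.log_le_log (by norm_num) (by norm_num)
  rw [Real.log_pow, Real.log_pow] at h3 h4
  norm_num at h1 h2 h3 h4 ⊢
  constructor <;> linarith

theorem log_pi_bounds : 1.143 < Real.log Real.pi ∧ Real.log Real.pi < 1.1482 := by
  obtain ⟨h1, h2⟩ := log_three_bounds
  have hp1 := Real.pi_gt_d6
  have hp2 := Real.pi_lt_d6
  have e : Real.log Real.pi = Real.log 3 + Real.log (1 + (Real.pi / 3 - 1)) := by
    rw [← Real.log_mul (by norm_num) (by linarith)]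
    congr 1; ring
  have h3 := Real.le_log_one_add_of_nonneg (x := Real.pi / 3 - 1) (by linarith)
  have h4 := Real.log_le_sub_one_of_pos (x := 1 + (Real.pi / 3 - 1)) (by linarith)
  have h5 : 0.046 ≤ 2 * (Real.pi / 3 - 1) / (Real.pi / 3 - 1 + 2) := by
    rw [le_div_iff₀ (by linarith)]; linarith
  constructor <;> linarith

/-- The tangent of the logarithm at `2 ^ m` lies above it. -/
theorem log_le_tangent {x : ℝ} (hx : 0 < x) (m : ℕ) :
    Real.log x ≤ m * Real.log 2 + x / 2 ^ m - 1 := by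
  have h := Real.log_le_sub_one_of_pos (x := x / 2 ^ m) (by positivity)
  rw [Real.log_div hx.ne' (by positivity), Real.log_pow] at h
  linarith

/-! ### The two inequalities between Gamma values -/

/-- The logarithm of the ratio between the volume of the Euclidean ball of radius `n ^ (-1/2)`
in dimension `x` and `2 ^ x / n! ^ (x / n)`. -/
noncomputable def euclideanGain (n : ℕ) (x : ℝ) : ℝ :=
  x / 2 * Real.log (Real.pi / 4) - Real.log (Real.Gamma (x / 2 + 1))
    - x * (Real.log n / 2 - Real.log n.factorial / n)

theorem concaveOn_euclideanGain (n : ℕ) : ConcaveOn ℝ (Set.Ici 0) (euclideanGain n) := by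
  have hlin : ConcaveOn ℝ (Set.Ici 0) fun x : ℝ =>
      x / 2 * Real.log (Real.pi / 4) - x * (Real.log n / 2 - Real.log n.factorial / n) := by
    refine ⟨convex_Ici 0, fun x _ y _ a b _ _ hab => le_of_eq ?_⟩
    simp only [smul_eq_mul]
    ring
  refine ((concaveOn_neg_log_Gamma.comp_half_add one_pos).add hlin).congr fun x _ => ?_
  simp only [Pi.add_apply, euclideanGain]
  ring

/-- By Stirling's formula, with `u = n - 1`, the claim becomes `hlogu`, an upper bound for
`(u + 2) log u` by a quadratic polynomial. It is tight enough at small `u` that `u = 2` is treated on its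
own. -/
theorem euclideanGain_half_pred_nonneg {n : ℕ} (hn : 3 ≤ n) :
    0 ≤ euclideanGain n (((n : ℝ) - 1) / 2) := by
  obtain ⟨P1, P2⟩ := log_pi_bounds
  have t1 := Real.log_two_gt_d9
  have t2 := Real.log_two_lt_d9
  obtain ⟨u, hu⟩ : ∃ u : ℝ, u = (n : ℝ) - 1 := ⟨_, rfl⟩
  have hn' : (n : ℝ) = u + 1 := by linarith
  have hu2 : 2 ≤ u := by
    have : (3 : ℝ) ≤ n := by exact_mod_cast hn
    linarith
  have hu0 : 0 < u := by linarith
  have hucases : u = 2 ∨ 3 ≤ u := by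
    rcases hn.eq_or_lt with h | h
    · left; rw [hu, ← h]; norm_num
    · right
      have : (4 : ℝ) ≤ n := by exact_mod_cast h
      linarith
  have hlogu : (u + 2) * Real.log u ≤ 0.143 * u ^ 2 + 2.0769 * u - 1.71 := by
    rcases hucases with rfl | h3
    · linarith
    -- tangents of the logarithm at `4` and at `8`
    rcases le_total u 8 with h8 | h8
    · have h := log_le_tangent hu0 2
      norm_num at h
      have : (u + 2) * Real.log u ≤ (u + 2) * (0.3863 + u / 4) := by
        apply mul_le_mul_of_nonneg_left _ (by linarith)
        linarith
      nlinarith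
    · have h := log_le_tangent hu0 3
      norm_num at h
      have : (u + 2) * Real.log u ≤ (u + 2) * (1.0795 + u / 8) := by
        apply mul_le_mul_of_nonneg_left _ (by linarith)
        linarith
      nlinarith
  have hG := stirlingRemainder_le (x := u / 4) (by positivity)
  have hF := le_stirlingRemainder (x := (n : ℝ)) (by linarith)
  have hdelta : 2 / (2 * u + 1) ≤ Real.log (u + 1) - Real.log u := by
    have h := Real.le_log_one_add_of_nonneg (x := 1 / u) (by positivity)
    rw [← Real.log_div (by linarith) hu0.ne']
    have e1 : (u + 1) / u = 1 + 1 / u := by field_simp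
    have e2 : 2 / (2 * u + 1) = 2 * (1 / u) / (1 / u + 2) := by field_simp; ring
    rw [e1, e2]
    exact h
  rw [stirlingRemainder, Real.Gamma_nat_eq_factorial] at hF
  rw [stirlingRemainder] at hG
  have l4 : Real.log 4 = 2 * Real.log 2 := by
    rw [show (4 : ℝ) = 2 ^ 2 by norm_num, Real.log_pow]; norm_num
  rw [Real.log_mul two_ne_zero Real.pi_ne_zero] at hG hF
  rw [Real.log_div hu0.ne' (by norm_num), l4] at hG
  rw [euclideanGain, ← hu, Real.log_div Real.pi_ne_zero (by norm_num), l4]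
  rw [hn'] at hF ⊢
  have e : u / 2 / 2 + 1 = u / 4 + 1 := by ring
  rw [e]
  generalize Real.log (Real.Gamma (u / 4 + 1)) = G at *
  generalize Real.log (n.factorial : ℝ) = F at *
  generalize Real.log Real.pi = P at *
  generalize Real.log 2 = T at *
  generalize hLn : Real.log (u + 1) = Ln at *
  generalize Real.log u = Lu at *
  have hFF : ((T + P) / 2 + (u + 1 + 1 / 2) * Ln - (u + 1)) / (u + 1) ≤ F / (u + 1) := by
    gcongr
    linarith
  have key : 0 ≤ u / 2 / 2 * (P - 2 * T) - ((T + P) / 2 + 1 / (12 * (u / 4)) +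
      (u / 4 + 1 / 2) * (Lu - 2 * T) - u / 4) - u / 2 * (Ln / 2 -
      ((T + P) / 2 + (u + 1 + 1 / 2) * Ln - (u + 1)) / (u + 1)) := by
    have e : u / 2 / 2 * (P - 2 * T) - ((T + P) / 2 + 1 / (12 * (u / 4)) +
      (u / 4 + 1 / 2) * (Lu - 2 * T) - u / 4) - u / 2 * (Ln / 2 -
      ((T + P) / 2 + (u + 1 + 1 / 2) * Ln - (u + 1)) / (u + 1)) =
      (1 / (4 * (u + 1))) * ((P - 1) * (u * (u + 1)) + (Ln - Lu) * (u * (u + 2)) + u * (T + P)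
        - 2 * (u + 1) * (P - T) - 4 * (u + 1) / (3 * u) - (u + 2) * Lu) := by
      field_simp
      ring
    rw [e]
    apply mul_nonneg (by positivity)
    have h1 : u + 1.2 ≤ (Ln - Lu) * (u * (u + 2)) := by
      calc u + 1.2 ≤ 2 / (2 * u + 1) * (u * (u + 2)) := by
            rw [div_mul_eq_mul_div, le_div_iff₀ (by positivity)]
            nlinarith
        _ ≤ _ := by gcongr
    have h2 : 4 * (u + 1) / (3 * u) ≤ 2 := by
      rw [div_le_iff₀ (by positivity)]; linarith
    have h3 : 0.143 * (u * (u + 1)) + u * (T + 1.143) - 2 * (u + 1) * (1.143 - T) ≤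
        (P - 1) * (u * (u + 1)) + u * (T + P) - 2 * (u + 1) * (P - T) := by
      have hu4 : 0 ≤ u ^ 2 - 2 := by nlinarith
      linarith [mul_nonneg (sub_nonneg.2 P1.le) hu4]
    linarith [mul_nonneg (sub_nonneg.2 t1.le) hu0.le]
  have hu' : 0 ≤ u / 2 := by positivity
  have := mul_le_mul_of_nonneg_left hFF hu'
  linarith

theorem euclideanGain_nonneg {n k : ℕ} (h : 2 * k + 1 ≤ n) : 0 ≤ euclideanGain n k := by
  rcases Nat.eq_zero_or_pos k with rfl | hk
  · simp [euclideanGain]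
  have hkn : 2 * (k : ℝ) + 1 ≤ n := by exact_mod_cast h
  have hk0 : (0 : ℝ) ≤ k := k.cast_nonneg
  refine (concaveOn_euclideanGain n).nonneg_of_endpoints (x := 0) (y := ((n : ℝ) - 1) / 2) (by simp)
    (by simp; linarith) (by simp [euclideanGain]) (euclideanGain_half_pred_nonneg (by omega))
    (by positivity) (by linarith)

/-- The logarithm of the ratio between `(n / π) ^ ((n - x) / 2) Γ((n + x) / 2) / (Γ(n) Γ(x + 1))`
and `1 / n! ^ (x / n)`. -/
noncomputable def fourierGain (n : ℕ) (x : ℝ) : ℝ :=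
  (n - x) / 2 * Real.log (n / Real.pi) + Real.log (Real.Gamma ((n + x) / 2))
    - Real.log (Real.Gamma n) - Real.log (Real.Gamma (x + 1)) + x / n * Real.log n.factorial

theorem concaveOn_fourierGain {n : ℕ} (hn : 1 ≤ n) :
    ConcaveOn ℝ (Set.Ici 0) (fourierGain n) := by
  have hlin : ConcaveOn ℝ (Set.Ici 0) fun x : ℝ => (n - x) / 2 * Real.log (n / Real.pi)
      - Real.log (Real.Gamma n) + x / n * Real.log n.factorial := by
    refine ⟨convex_Ici 0, fun x _ y _ a b _ _ hab => le_of_eq ?_⟩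
    simp only [smul_eq_mul]
    linear_combination (n / 2 * Real.log (n / Real.pi) - Real.log (Real.Gamma n)) * hab
  refine ((concaveOn_log_Gamma_half_sub hn).add hlin).congr fun x _ => ?_
  simp only [Pi.add_apply, fourierGain]
  ring

theorem fourierGain_self {n : ℕ} (hn : 1 ≤ n) : fourierGain n n = 0 := by
  have hn' : (n : ℝ) ≠ 0 := by positivity
  have e : ((n : ℝ) + n) / 2 = n := by ring
  rw [fourierGain, e, Real.Gamma_nat_eq_factorial, div_self hn']
  ring

/-- With `j = n / 2`, Stirling's formula leaves an expression that is essentially linear in `j` with positive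
slope; the tangent of the logarithm at `2` controls the term `-(log j) / 4`. -/
theorem fourierGain_half_nonneg_of_five_le {n : ℕ} (hn : 5 ≤ n) :
    0 ≤ fourierGain n ((n : ℝ) / 2) := by
  obtain ⟨P1, P2⟩ := log_pi_bounds
  obtain ⟨h31, h32⟩ := log_three_bounds
  have t1 := Real.log_two_gt_d9
  have t2 := Real.log_two_lt_d9
  obtain ⟨j, hj⟩ : ∃ j : ℝ, j = (n : ℝ) / 2 := ⟨_, rfl⟩
  have hn' : (n : ℝ) = 2 * j := by linarith
  have hj2 : 5 / 2 ≤ j := by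
    have : (5 : ℝ) ≤ n := by exact_mod_cast hn
    linarith
  have hj0 : 0 < j := by linarith
  have hA := le_stirlingRemainder (x := 3 * j / 2) (by positivity)
  have hB := stirlingRemainder_le (x := (n : ℝ)) (by linarith)
  have hC := stirlingRemainder_le (x := j) hj0
  have hlogj := log_le_tangent hj0 1
  have g1 : Real.log (Real.Gamma n) = Real.log n.factorial - Real.log n := by
    rw [← Real.Gamma_nat_eq_factorial, Real.log_Gamma_add_one (by linarith)]
    ring
  rw [stirlingRemainder, Real.log_Gamma_add_one (by positivity)] at hA
  rw [stirlingRemainder, Real.Gamma_nat_eq_factorial] at hB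
  rw [stirlingRemainder] at hC
  have l3 : Real.log (3 * j / 2) = Real.log 3 + Real.log j - Real.log 2 := by
    rw [Real.log_div (by positivity) two_ne_zero, Real.log_mul three_ne_zero hj0.ne']
  have l2 : Real.log (n : ℝ) = Real.log 2 + Real.log j := by
    rw [hn', Real.log_mul two_ne_zero hj0.ne']
  rw [Real.log_mul two_ne_zero Real.pi_ne_zero] at hA hB hC
  rw [l2] at hB
  rw [l3] at hA
  rw [fourierGain, ← hj, g1, Real.log_div (by linarith) Real.pi_ne_zero, l2]
  rw [hn'] at hB ⊢
  have e1 : (2 * j + j) / 2 = 3 * j / 2 := by ring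
  have e2 : j / (2 * j) = 1 / 2 := by field_simp
  rw [e1, e2]
  generalize Real.log (Real.Gamma (3 * j / 2)) = A at *
  generalize Real.log (n.factorial : ℝ) = F at *
  generalize Real.log (Real.Gamma (j + 1)) = C at *
  generalize Real.log Real.pi = P at *
  generalize Real.log 2 = T at *
  generalize Real.log 3 = R at *
  generalize Real.log j = J at *
  have hinv : 5 / 48 / j ≤ 1 / 24 := by
    rw [div_le_iff₀ hj0]; linarith
  have key : 0 ≤ T - R / 2 - P / 4 - J / 4 + (1 / 2 + 3 / 2 * R - 2 * T - P / 2) * j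
      - 5 / 48 / j := by
    norm_num at hlogj
    have : 0.18 * j + 2.5 * (3 / 2 * R - 2 * T - P / 2 + 0.32) ≤
        (1 / 2 + 3 / 2 * R - 2 * T - P / 2) * j := by
      nlinarith
    linarith
  have e3 : 1 / (12 * (2 * j)) = 5 / 48 / j * (2 / 5) := by field_simp; norm_num
  have e4 : 1 / (12 * j) = 5 / 48 / j * (4 / 5) := by field_simp; norm_num
  rw [e3] at hB
  rw [e4] at hC
  linarith

theorem fourierGain_one_of_two : fourierGain 2 1 = 0 := by
  have h : Real.Gamma ((2 + 1) / 2) = √Real.pi / 2 := by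
    rw [show ((2 : ℝ) + 1) / 2 = 1 / 2 + 1 by norm_num, Real.Gamma_add_one (by norm_num),
      Real.Gamma_one_half_eq]
    ring
  have e : (1 : ℝ) + 1 = 2 := by norm_num
  simp only [fourierGain, Nat.cast_ofNat, h, e, Real.Gamma_two]
  rw [Real.log_div two_ne_zero Real.pi_ne_zero, Real.log_div (by positivity) two_ne_zero,
    Real.log_sqrt Real.pi_nonneg]
  norm_num [Nat.factorial]
  ring

theorem fourierGain_two_of_three : 0 ≤ fourierGain 3 2 := by
  have h : Real.Gamma ((3 + 2) / 2) = 3 / 4 * √Real.pi := by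
    rw [show ((3 : ℝ) + 2) / 2 = 1 / 2 + 1 + 1 by norm_num, Real.Gamma_add_one (by norm_num),
      Real.Gamma_add_one (by norm_num), Real.Gamma_one_half_eq]
    ring
  have h3 : Real.Gamma 3 = 2 := by norm_num [Real.Gamma_ofNat_eq_factorial, Nat.factorial]
  have e : (2 : ℝ) + 1 = 3 := by norm_num
  have hf : ((Nat.factorial 3 : ℕ) : ℝ) = 2 * 3 := by norm_num [Nat.factorial]
  simp only [fourierGain, Nat.cast_ofNat, h, e, h3, hf]
  rw [Real.log_div three_ne_zero Real.pi_ne_zero, Real.log_mul (by norm_num) (by positivity),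
    Real.log_sqrt Real.pi_nonneg, Real.log_mul two_ne_zero three_ne_zero,
    Real.log_div three_ne_zero (by norm_num), show (4 : ℝ) = 2 ^ 2 by norm_num, Real.log_pow]
  have := log_three_bounds
  have := Real.log_two_lt_d9
  push_cast
  linarith

theorem fourierGain_two_of_four : 0 ≤ fourierGain 4 2 := by
  have h3 : Real.Gamma 3 = 2 := by norm_num [Real.Gamma_ofNat_eq_factorial, Nat.factorial]
  have h4 : Real.Gamma 4 = 2 * 3 := by norm_num [Real.Gamma_ofNat_eq_factorial, Nat.factorial]
  have e : (2 : ℝ) + 1 = 3 := by norm_num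
  have e2 : ((4 : ℝ) + 2) / 2 = 3 := by norm_num
  have hf : ((Nat.factorial 4 : ℕ) : ℝ) = 2 ^ 3 * 3 := by norm_num [Nat.factorial]
  simp only [fourierGain, Nat.cast_ofNat, e, e2, h3, h4, hf]
  rw [Real.log_div (by norm_num) Real.pi_ne_zero, Real.log_mul two_ne_zero three_ne_zero,
    Real.log_mul (by norm_num) (by norm_num), show (4 : ℝ) = 2 ^ 2 by norm_num, Real.log_pow,
    Real.log_pow]
  have := log_three_bounds
  have := log_pi_bounds
  have := Real.log_two_gt_d9
  push_cast
  linarith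

theorem fourierGain_nonneg {n k : ℕ} (hn : 1 ≤ n) (h : n ≤ 2 * k) (hkn : k ≤ n) :
    0 ≤ fourierGain n k := by
  have hkn' : (k : ℝ) ≤ n := by exact_mod_cast hkn
  have h' : (n : ℝ) ≤ 2 * k := by exact_mod_cast h
  rcases hkn.eq_or_lt with rfl | hlt
  · exact (fourierGain_self hn).ge
  rcases le_or_gt 5 n with h5 | h5
  · exact (concaveOn_fourierGain hn).nonneg_of_endpoints (x := (n : ℝ) / 2) (y := n)
      (by simp; positivity) (by simp) (fourierGain_half_nonneg_of_five_le h5) (fourierGain_self hn).ge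
      (by linarith) hkn'
  -- Stirling's formula is too weak here: for `n = 2` and `k = 1` equality holds.
  · interval_cases n
    · omega
    · obtain rfl : k = 1 := by omega
      simpa using fourierGain_one_of_two.ge
    · obtain rfl : k = 2 := by omega
      simpa using fourierGain_two_of_three
    · refine (concaveOn_fourierGain hn).nonneg_of_endpoints (x := 2) (y := 4)
        (by simp) (by simp) fourierGain_two_of_four ?_ ?_ ?_
      · have := fourierGain_self (n := 4) (by norm_num)
        push_cast at this
        exact this.ge
      · push_cast at h'; linarith
      · push_cast at hkn'; linarith

/-! ### Integrals over Euclidean spaces -/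

theorem lintegral_Ioi_ofReal {g : ℝ → ℝ} (hg : IntegrableOn g (Set.Ioi 0)) (h0 : ∀ t, 0 < t → 0 ≤ g t) :
    ∫⁻ t in Set.Ioi (0 : ℝ), ENNReal.ofReal (g t) = ENNReal.ofReal (∫ t in Set.Ioi 0, g t) :=
  (ofReal_integral_eq_lintegral_ofReal hg
    ((ae_restrict_iff' measurableSet_Ioi).2 (Eventually.of_forall h0))).symm

theorem lintegral_rpow_mul_exp_neg_mul_Ioi {a r : ℝ} (ha : 0 < a) (hr : 0 < r) :
    ∫⁻ t in Set.Ioi (0 : ℝ), ENNReal.ofReal (t ^ (a - 1) * Real.exp (-(r * t))) =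
      ENNReal.ofReal ((1 / r) ^ a * Real.Gamma a) := by
  rw [lintegral_Ioi_ofReal, Real.integral_rpow_mul_exp_neg_mul_Ioi ha hr]
  · have h := integrableOn_rpow_mul_exp_neg_mul_rpow (s := a - 1) (p := 1) (b := r) (by linarith)
      one_pos hr
    simpa using h
  · intro t ht; positivity

open scoped Pointwise in
/-- The integral of `exp (-φ)` for a `p`-homogeneous `φ ≥ 0` determines the volume of `{φ ≤ 1}`. -/
theorem lintegral_exp_neg_of_homogeneous {X : Type*} [NormedAddCommGroup X] [NormedSpace ℝ X]
    [MeasurableSpace X] [BorelSpace X] [FiniteDimensional ℝ X] (μ : Measure X) [μ.IsAddHaarMeasure]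
    {φ : X → ℝ} {p : ℝ} (hp : 0 < p) (hφm : Measurable φ) (hφ0 : ∀ x, 0 ≤ φ x)
    (hφ : ∀ (r : ℝ) (x : X), 0 < r → φ (r • x) = r ^ p * φ x) :
    ∫⁻ x, ENNReal.ofReal (Real.exp (-φ x)) ∂μ =
      ENNReal.ofReal (Real.Gamma (1 + Module.finrank ℝ X / p)) * μ {x | φ x ≤ 1} := by
  set d := Module.finrank ℝ X
  have h1 : ∀ x, ENNReal.ofReal (Real.exp (-φ x)) = ∫⁻ t in Set.Ioi (0 : ℝ),
      Set.indicator {q : X × ℝ | φ q.1 ≤ q.2} (fun q => ENNReal.ofReal (Real.exp (-q.2))) (x, t) := by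
    intro x
    have e : ∀ t : ℝ, Set.indicator {q : X × ℝ | φ q.1 ≤ q.2}
        (fun q => ENNReal.ofReal (Real.exp (-q.2))) (x, t) =
        Set.indicator (Set.Ici (φ x)) (fun t => ENNReal.ofReal (Real.exp (-t))) t := fun t => rfl
    simp only [e]
    rw [lintegral_indicator measurableSet_Ici, Measure.restrict_restrict measurableSet_Ici]
    have e2 : (Set.Ici (φ x) ∩ Set.Ioi 0 : Set ℝ) =ᵐ[volume] Set.Ioi (φ x) := by
      rcases (hφ0 x).eq_or_lt with h | h
      · rw [← h, Set.inter_eq_right.2 Set.Ioi_subset_Ici_self]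
        exact EventuallyEq.rfl
      · have e3 : Set.Ici (φ x) ∩ Set.Ioi 0 = Set.Ici (φ x) :=
          Set.inter_eq_left.2 fun t ht => h.trans_le ht
        rw [e3]
        exact Ioi_ae_eq_Ici.symm
    rw [Measure.restrict_congr_set e2, ← ofReal_integral_eq_lintegral_ofReal
      (integrableOn_exp_neg_Ioi _) (Eventually.of_forall fun t => (Real.exp_pos _).le),
      integral_exp_neg_Ioi]
  have h2 : ∀ t : ℝ, 0 < t → μ {x | φ x ≤ t} = ENNReal.ofReal (t ^ (d / p)) * μ {x | φ x ≤ 1} := by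
    intro t ht
    have hr : 0 < t ^ (1 / p) := Real.rpow_pos_of_pos ht _
    have e : {x | φ x ≤ t} = (t ^ (1 / p)) • {x | φ x ≤ 1} := by
      ext x
      rw [Set.mem_smul_set_iff_inv_smul_mem₀ hr.ne', Set.mem_ofPred_eq, Set.mem_ofPred_eq,
        hφ _ _ (inv_pos.2 hr), Real.inv_rpow hr.le, ← Real.rpow_mul ht.le, one_div_mul_cancel hp.ne',
        Real.rpow_one, inv_mul_le_iff₀ ht, mul_one]
    rw [e, Measure.addHaar_smul, abs_of_pos (by positivity), ← Real.rpow_natCast,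
      ← Real.rpow_mul ht.le]
    congr 3
    ring
  simp only [h1]
  have hm : Measurable fun q : X × ℝ => Set.indicator {q : X × ℝ | φ q.1 ≤ q.2}
      (fun q => ENNReal.ofReal (Real.exp (-q.2))) q := by
    refine Measurable.indicator (by fun_prop) ?_
    exact measurableSet_le (by fun_prop) (by fun_prop)
  rw [lintegral_lintegral_swap hm.aemeasurable]
  have h3 : ∀ t ∈ Set.Ioi (0 : ℝ), ∫⁻ x, Set.indicator {q : X × ℝ | φ q.1 ≤ q.2}
      (fun q => ENNReal.ofReal (Real.exp (-q.2))) (x, t) ∂μ =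
      ENNReal.ofReal (t ^ (1 + d / p - 1) * Real.exp (-(1 * t))) * μ {x | φ x ≤ 1} := by
    intro t ht
    have e : ∀ x : X, Set.indicator {q : X × ℝ | φ q.1 ≤ q.2}
        (fun q => ENNReal.ofReal (Real.exp (-q.2))) (x, t) =
        Set.indicator {x | φ x ≤ t} (fun _ => ENNReal.ofReal (Real.exp (-t))) x := fun x => rfl
    simp only [e]
    rw [lintegral_indicator_const (measurableSet_le hφm measurable_const), h2 t ht, ← mul_assoc,
      ← ENNReal.ofReal_mul (Real.exp_pos _).le, one_mul, mul_comm (Real.exp _)]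
    congr 4
    ring
  rw [setLIntegral_congr_fun measurableSet_Ioi h3, lintegral_mul_const'' _ (by fun_prop),
    lintegral_rpow_mul_exp_neg_mul_Ioi (by positivity) one_pos]
  simp

theorem integral_exp_neg_of_homogeneous {X : Type*} [NormedAddCommGroup X] [NormedSpace ℝ X]
    [MeasurableSpace X] [BorelSpace X] [FiniteDimensional ℝ X] (μ : Measure X) [μ.IsAddHaarMeasure]
    {φ : X → ℝ} {p : ℝ} (hp : 0 < p) (hφm : Measurable φ) (hφ0 : ∀ x, 0 ≤ φ x)
    (hφ : ∀ (r : ℝ) (x : X), 0 < r → φ (r • x) = r ^ p * φ x) :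
    ∫ x, Real.exp (-φ x) ∂μ =
      Real.Gamma (1 + Module.finrank ℝ X / p) * μ.real {x | φ x ≤ 1} := by
  rw [integral_eq_lintegral_of_nonneg_ae (Eventually.of_forall fun x => (Real.exp_pos _).le)
    (by fun_prop), lintegral_exp_neg_of_homogeneous μ hp hφm hφ0 hφ, ENNReal.toReal_mul,
    ENNReal.toReal_ofReal (Real.Gamma_pos_of_pos (by positivity)).le, measureReal_def]

/-- The integral of `(1 + b ‖x‖²) ^ (-s)`, written as a mixture of Gaussians. -/
theorem lintegral_one_add_mul_norm_sq_rpow_neg {X : Type*} [NormedAddCommGroup X]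
    [InnerProductSpace ℝ X] [MeasurableSpace X] [BorelSpace X] [FiniteDimensional ℝ X]
    {b s : ℝ} (hb : 0 < b) (hs : (Module.finrank ℝ X : ℝ) / 2 < s) :
    ∫⁻ x : X, ENNReal.ofReal ((1 + b * ‖x‖ ^ 2) ^ (-s)) =
      ENNReal.ofReal ((Real.pi / b) ^ ((Module.finrank ℝ X : ℝ) / 2) *
        Real.Gamma (s - (Module.finrank ℝ X : ℝ) / 2) / Real.Gamma s) := by
  obtain ⟨d, hd⟩ : ∃ d : ℝ, d = Module.finrank ℝ X := ⟨_, rfl⟩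
  have hd0 : 0 ≤ d := hd ▸ Nat.cast_nonneg _
  rw [← hd] at hs ⊢
  have hs0 : 0 < s := lt_of_le_of_lt (by positivity) hs
  have hG := Real.Gamma_pos_of_pos hs0
  have h1 : ∀ x : X, ENNReal.ofReal ((1 + b * ‖x‖ ^ 2) ^ (-s)) = ENNReal.ofReal (1 / Real.Gamma s) *
      ∫⁻ t in Set.Ioi (0 : ℝ),
        ENNReal.ofReal (t ^ (s - 1) * Real.exp (-((1 + b * ‖x‖ ^ 2) * t))) := by
    intro x
    rw [lintegral_rpow_mul_exp_neg_mul_Ioi hs0 (by positivity), ← ENNReal.ofReal_mul (by positivity)]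
    congr 1
    rw [Real.rpow_neg (by positivity), Real.div_rpow one_pos.le (by positivity), Real.one_rpow]
    field_simp
  simp only [h1]
  rw [lintegral_const_mul' _ _ ENNReal.ofReal_ne_top]
  have hm : Measurable fun q : X × ℝ =>
      ENNReal.ofReal (q.2 ^ (s - 1) * Real.exp (-((1 + b * ‖q.1‖ ^ 2) * q.2))) := by fun_prop
  rw [lintegral_lintegral_swap hm.aemeasurable]
  have h2 : ∀ t ∈ Set.Ioi (0 : ℝ),
      ∫⁻ x : X, ENNReal.ofReal (t ^ (s - 1) * Real.exp (-((1 + b * ‖x‖ ^ 2) * t))) =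
      ENNReal.ofReal ((Real.pi / b) ^ (d / 2)) *
        ENNReal.ofReal (t ^ (s - d / 2 - 1) * Real.exp (-(1 * t))) := by
    intro t ht
    rw [Set.mem_Ioi] at ht
    have e : ∀ x : X, ENNReal.ofReal (t ^ (s - 1) * Real.exp (-((1 + b * ‖x‖ ^ 2) * t))) =
        ENNReal.ofReal (t ^ (s - 1) * Real.exp (-t)) *
          ENNReal.ofReal (Real.exp (-(b * t) * ‖x‖ ^ 2)) := by
      intro x
      rw [← ENNReal.ofReal_mul (by positivity), mul_assoc, ← Real.exp_add]
      congr 3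
      ring
    have hbt : 0 < b * t := by positivity
    have hint : Integrable fun x : X => Real.exp (-(b * t) * ‖x‖ ^ 2) := by
      have h := GaussianFourier.integrable_cexp_neg_mul_sq_norm_add (V := X) (b := (b * t : ℝ))
        (by simpa using hbt) 0 0
      have h' := h.re
      refine h'.congr (Eventually.of_forall fun x => ?_)
      have e : (-((b * t : ℝ) : ℂ) * (‖x‖ : ℂ) ^ 2 + 0 * ((inner ℝ (0 : X) x : ℝ) : ℂ)) =
          ((-(b * t) * ‖x‖ ^ 2 : ℝ) : ℂ) := by push_cast; ring
      dsimp only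
      rw [e, ← Complex.ofReal_exp]
      exact Complex.ofReal_re _
    simp only [e]
    rw [lintegral_const_mul' _ _ ENNReal.ofReal_ne_top, ← ofReal_integral_eq_lintegral_ofReal
      hint (Eventually.of_forall fun x => (Real.exp_pos _).le),
      GaussianFourier.integral_rexp_neg_mul_sq_norm hbt, ← hd, ← ENNReal.ofReal_mul (by positivity),
      ← ENNReal.ofReal_mul (by positivity)]
    congr 1
    rw [show Real.pi / (b * t) = (Real.pi / b) / t by field_simp, Real.div_rpow (by positivity) ht.le,
      show s - d / 2 - 1 = (s - 1) - d / 2 by ring, Real.rpow_sub ht (s - 1) (d / 2), one_mul]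
    ring
  rw [setLIntegral_congr_fun measurableSet_Ioi h2, lintegral_const_mul' _ _ ENNReal.ofReal_ne_top,
    lintegral_rpow_mul_exp_neg_mul_Ioi (by linarith) one_pos, ← ENNReal.ofReal_mul (by positivity),
    ← ENNReal.ofReal_mul (by positivity)]
  congr 1
  simp
  ring

theorem integral_exp_neg_abs_rpow {p : ℝ} (hp : 0 < p) :
    ∫ t : ℝ, Real.exp (-|t| ^ p) = 2 * Real.Gamma (1 + 1 / p) := by
  rw [integral_comp_abs (f := fun t => Real.exp (-t ^ p)), integral_exp_neg_rpow hp, add_comm (1 / p)]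

/-! ### Volumes of `ℓ^p` balls and of their sections -/

theorem continuous_sum_abs_rpow {ι : Type*} [Fintype ι] {p : ℝ} (hp : 0 < p) :
    Continuous fun x : EuclideanSpace ℝ ι => ∑ i, |x i| ^ p :=
  continuous_finsetSum _ fun i _ => Continuous.rpow_const (by fun_prop) fun _ => Or.inr hp.le

theorem sum_abs_rpow_smul {ι : Type*} [Fintype ι] {p r : ℝ} (hr : 0 < r) (x : EuclideanSpace ℝ ι) :
    ∑ i, |(r • x) i| ^ p = r ^ p * ∑ i, |x i| ^ p := by
  rw [Finset.mul_sum]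
  refine Finset.sum_congr rfl fun i _ => ?_
  rw [PiLp.smul_apply, smul_eq_mul, abs_mul, abs_of_pos hr, Real.mul_rpow hr.le (abs_nonneg _)]

/-- The volume of the unit ball `B_p^n`, also in the range `p < 1` where it is not convex. -/
theorem volume_real_lpBall (n : ℕ) {p : ℝ} (hp : 0 < p) :
    volume.real (lpBall n p) =
      (2 * Real.Gamma (1 + 1 / p)) ^ n / Real.Gamma (1 + n / p) := by
  have h1 := integral_exp_neg_of_homogeneous (volume : Measure (EuclideanSpace ℝ (Fin n))) hp
    (continuous_sum_abs_rpow hp).measurable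
    (fun x => Finset.sum_nonneg fun i _ => Real.rpow_nonneg (abs_nonneg _) _)
    (fun r x hr => sum_abs_rpow_smul hr x)
  have h2 : ∫ x : EuclideanSpace ℝ (Fin n), Real.exp (-∑ i, |x i| ^ p) =
      (2 * Real.Gamma (1 + 1 / p)) ^ n := by
    rw [← integral_exp_neg_abs_rpow hp]
    have h := integral_fintype_prod_volume_eq_pow (ι := Fin n) (fun t : ℝ => Real.exp (-|t| ^ p))
    rw [Fintype.card_fin] at h
    rw [← h, ← (PiLp.volume_preserving_ofLp (Fin n)).integral_comp
      (MeasurableEquiv.toLp 2 (Fin n → ℝ)).symm.measurableEmbedding]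
    refine integral_congr_ae (Eventually.of_forall fun x => ?_)
    simp only [← Real.exp_sum, Finset.sum_neg_distrib]
  rw [h2, finrank_euclideanSpace_fin] at h1
  rw [eq_div_iff (Real.Gamma_pos_of_pos (by positivity)).ne', h1, mul_comm]
  rfl

theorem abs_le_one_of_mem_lpBall {n : ℕ} {p : ℝ} (hp : 0 < p) {x : EuclideanSpace ℝ (Fin n)}
    (hx : x ∈ lpBall n p) (i : Fin n) : |x i| ≤ 1 := by
  have h : |x i| ^ p ≤ 1 := (Finset.single_le_sum (f := fun i => |x i| ^ p)
    (fun i _ => Real.rpow_nonneg (abs_nonneg _) _) (Finset.mem_univ i)).trans hx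
  by_contra! h1
  exact absurd (Real.one_lt_rpow h1 hp) (not_lt.2 h)

theorem isBounded_lpBall (n : ℕ) {p : ℝ} (hp : 0 < p) : Bornology.IsBounded (lpBall n p) := by
  refine (Metric.isBounded_closedBall (x := 0) (r := √n)).subset fun x hx => ?_
  rw [mem_closedBall_zero_iff, EuclideanSpace.norm_eq]
  refine Real.sqrt_le_sqrt ?_
  calc ∑ i, ‖x i‖ ^ 2 ≤ ∑ _i : Fin n, (1 : ℝ) := Finset.sum_le_sum fun i _ => by
        rw [Real.norm_eq_abs]
        exact pow_le_one₀ (abs_nonneg _) (abs_le_one_of_mem_lpBall hp hx i)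
    _ = n := by simp

/-- The section volume does not depend on the chosen coordinates: it is the volume in `E`. -/
theorem sectionVolume_eq {n : ℕ} (E : Submodule ℝ (EuclideanSpace ℝ (Fin n)))
    (A : Set (EuclideanSpace ℝ (Fin n))) :
    sectionVolume E A = (volume : Measure E).real {x : E | (x : EuclideanSpace ℝ (Fin n)) ∈ A} := by
  rw [sectionVolume, measureReal_def, measureReal_def]
  congr 1
  exact (stdOrthonormalBasis ℝ E).repr.symm.measurePreserving.measure_preimage_equiv
    (f := (stdOrthonormalBasis ℝ E).repr.symm.toHomeomorph.toMeasurableEquiv)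
    {x : E | (x : EuclideanSpace ℝ (Fin n)) ∈ A}

theorem measure_section_lpBall_lt_top {n : ℕ} (E : Submodule ℝ (EuclideanSpace ℝ (Fin n))) {p : ℝ}
    (hp : 0 < p) :
    (volume : Measure E) {x : E | (x : EuclideanSpace ℝ (Fin n)) ∈ lpBall n p} < ⊤ := by
  refine Bornology.IsBounded.measure_lt_top ?_
  obtain ⟨R, hR⟩ := (isBounded_lpBall n hp).exists_norm_le
  exact isBounded_iff_forall_norm_le.2 ⟨R, fun x hx => hR _ hx⟩

/-! ### Fourier transforms -/

open FourierTransform in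
/-- If the Fourier transform of `h` is real and bounded below by an integrable `G`, then `h 0` is at
least the integral of `G`. The inversion formula is used only with a Gaussian weight, so that
the Fourier transform itself need not be integrable. -/
theorem integral_le_re_of_le_fourier {F : Type*} [NormedAddCommGroup F] [InnerProductSpace ℝ F]
    [MeasurableSpace F] [BorelSpace F] [FiniteDimensional ℝ F] {h : F → ℂ} {g G : F → ℝ}
    (hi : Integrable h) (hc : ContinuousAt h 0) (hg : ∀ w, 𝓕 h w = (g w : ℂ))
    (hG : Integrable G) (hGg : ∀ w, G w ≤ g w) : ∫ w, G w ≤ (h 0).re := by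
  have hpair : ∀ c : ℝ, 0 < c →
      ∫ w : F, ((Real.pi * c : ℂ) ^ (Module.finrank ℝ F / 2 : ℂ) *
        Complex.exp (-Real.pi ^ 2 * c * ‖(0 : F) - w‖ ^ 2)) • h w =
      ∫ w : F, Complex.exp (-(c : ℂ)⁻¹ * ‖w‖ ^ 2) • (g w : ℂ) := by
    intro c hcpos
    have hcre : 0 < ((c : ℂ)⁻¹).re := by
      rw [← Complex.ofReal_inv, Complex.ofReal_re]; positivity
    have J : Integrable (fun w : F => Complex.exp (-(c : ℂ)⁻¹ * ‖w‖ ^ 2)) := by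
      simpa using GaussianFourier.integrable_cexp_neg_mul_sq_norm_add hcre 0 (0 : F)
    have e := (VectorFourier.integral_fourierIntegral_smul_eq_flip (L := innerₗ F)
      Real.continuous_fourierChar continuous_inner J hi)
    have e' : ∫ w : F, (𝓕 (fun w : F => Complex.exp (-(c : ℂ)⁻¹ * ‖w‖ ^ 2)) w) • h w =
        ∫ w : F, Complex.exp (-(c : ℂ)⁻¹ * ‖w‖ ^ 2) • 𝓕 h w := by
      simpa using! e
    simp only [hg] at e'
    rw [← e']
    congr with w
    rw [fourier_gaussian_innerProductSpace hcre]
    congr 2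
    · simp
    · simp; ring_nf
  have hA : Tendsto (fun c : ℝ => ∫ w : F, Complex.exp (-(c : ℂ)⁻¹ * ‖w‖ ^ 2) • (g w : ℂ)) atTop
      (𝓝 (h 0)) := by
    refine (Real.tendsto_integral_gaussian_smul' hi hc).congr' ?_
    filter_upwards [eventually_gt_atTop 0] with c hcpos using hpair c hcpos
  have hB := Real.tendsto_integral_cexp_sq_smul (f := fun w => (G w : ℂ)) hG.ofReal
  simp only [Complex.ofReal_inv] at hB
  have hg' : g = fun w => (𝓕 h w).re := by
    funext w; rw [hg, Complex.ofReal_re]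
  have hgcont : Continuous g := by
    rw [hg']
    exact Complex.continuous_re.comp (VectorFourier.fourierIntegral_continuous
      Real.continuous_fourierChar continuous_inner hi)
  have hgbdd : ∀ w, ‖g w‖ ≤ ∫ v, ‖h v‖ := by
    intro w
    have h1 : ‖𝓕 h w‖ ≤ ∫ v, ‖h v‖ := VectorFourier.norm_fourierIntegral_le_integral_norm _ _ _ _ _
    rwa [hg, Complex.norm_real] at h1
  have hreal : ∀ (c : ℝ) (k : F → ℝ), ∫ w : F, Complex.exp (-(c : ℂ)⁻¹ * ‖w‖ ^ 2) • (k w : ℂ) =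
      ((∫ w : F, Real.exp (-c⁻¹ * ‖w‖ ^ 2) * k w : ℝ) : ℂ) := by
    intro c k
    rw [← integral_complex_ofReal]
    congr with w
    push_cast
    rw [smul_eq_mul]
  have hB' := (Complex.continuous_re.tendsto _).comp hB
  have hA' := (Complex.continuous_re.tendsto _).comp hA
  rw [integral_complex_ofReal, Complex.ofReal_re] at hB'
  refine le_of_tendsto_of_tendsto hB' hA' ?_
  filter_upwards [eventually_gt_atTop 0] with c hcpos
  have e1 := hreal c G
  have e2 := hreal c g
  simp only [Function.comp_apply, e1, e2, Complex.ofReal_re]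
  have hgauss : Integrable fun w : F => Real.exp (-c⁻¹ * ‖w‖ ^ 2) := by
    have hcre : 0 < ((c : ℂ)⁻¹).re := by
      rw [← Complex.ofReal_inv, Complex.ofReal_re]; positivity
    have J : Integrable (fun w : F => Complex.exp (-(c : ℂ)⁻¹ * ‖w‖ ^ 2)) := by
      simpa using GaussianFourier.integrable_cexp_neg_mul_sq_norm_add hcre 0 (0 : F)
    refine J.re.congr (Eventually.of_forall fun w => ?_)
    have e : (-(c : ℂ)⁻¹ * (‖w‖ : ℂ) ^ 2) = ((-c⁻¹ * ‖w‖ ^ 2 : ℝ) : ℂ) := by push_cast; ring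
    dsimp only
    rw [e, ← Complex.ofReal_exp]
    exact Complex.ofReal_re _
  refine integral_mono ?_ ?_ fun w => mul_le_mul_of_nonneg_left (hGg w) (Real.exp_pos _).le
  · refine hG.bdd_mul (c := 1) (by fun_prop) (Eventually.of_forall fun w => ?_)
    rw [Real.norm_eq_abs, Real.abs_exp, Real.exp_le_one_iff]
    have : 0 ≤ c⁻¹ * ‖w‖ ^ 2 := by positivity
    linarith
  · exact hgauss.mul_bdd (c := ∫ v, ‖h v‖) hgcont.aestronglyMeasurable
      (Eventually.of_forall hgbdd)

/-- The Fourier transform of the two-sided exponential density. -/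
theorem integral_cexp_mul_exp_neg_abs (a : ℝ) :
    ∫ t : ℝ, Complex.exp (((-a * t : ℝ) : ℂ) * Complex.I) * ((Real.exp (-|t|) : ℝ) : ℂ) =
      ((2 / (1 + a ^ 2) : ℝ) : ℂ) := by
  have h1 : ∀ t ∈ Set.Iic (0 : ℝ), Complex.exp (((-a * t : ℝ) : ℂ) * Complex.I) *
      ((Real.exp (-|t|) : ℝ) : ℂ) = Complex.exp ((1 - a * Complex.I) * t) := by
    intro t ht
    rw [abs_of_nonpos ht, Complex.ofReal_exp, ← Complex.exp_add]
    congr 1; push_cast; ring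
  have h2 : ∀ t ∈ Set.Ioi (0 : ℝ), Complex.exp (((-a * t : ℝ) : ℂ) * Complex.I) *
      ((Real.exp (-|t|) : ℝ) : ℂ) = Complex.exp ((-1 - a * Complex.I) * t) := by
    intro t ht
    rw [abs_of_pos ht, Complex.ofReal_exp, ← Complex.exp_add]
    congr 1; push_cast; ring
  have r1 : 0 < (1 - a * Complex.I : ℂ).re := by simp
  have r2 : (-1 - a * Complex.I : ℂ).re < 0 := by simp
  have i1 := (integrableOn_exp_mul_complex_Iic r1 0).congr_fun (fun t ht => (h1 t ht).symm)
    measurableSet_Iic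
  have i2 := (integrableOn_exp_mul_complex_Ioi r2 0).congr_fun (fun t ht => (h2 t ht).symm)
    measurableSet_Ioi
  rw [← intervalIntegral.integral_Iic_add_Ioi i1 i2, setIntegral_congr_fun measurableSet_Iic h1,
    setIntegral_congr_fun measurableSet_Ioi h2, integral_exp_mul_complex_Iic r1,
    integral_exp_mul_complex_Ioi r2]
  have n1 : (1 - a * Complex.I : ℂ) ≠ 0 := fun h => by rw [h] at r1; simp at r1
  have n2 : (-1 - a * Complex.I : ℂ) ≠ 0 := fun h => by rw [h] at r2; simp at r2
  have n3 : (1 + a ^ 2 : ℂ) ≠ 0 := by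
    have : (1 + a ^ 2 : ℝ) ≠ 0 := by positivity
    exact_mod_cast this
  simp only [Complex.ofReal_zero, mul_zero, Complex.exp_zero]
  push_cast
  field_simp
  ring_nf
  simp only [Complex.I_sq]
  ring

theorem integrable_exp_neg_sum_abs (n : ℕ) :
    Integrable fun z : EuclideanSpace ℝ (Fin n) => Real.exp (-∑ i, |z i|) := by
  have h1 : Integrable fun t : ℝ => Real.exp (-|t|) := by
    rw [← integrableOn_univ, ← Set.Iic_union_Ioi (a := (0 : ℝ))]
    refine IntegrableOn.union ?_ ?_
    · refine (integrableOn_exp_Iic 0).congr_fun (fun t ht => ?_) measurableSet_Iic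
      simp only [abs_of_nonpos (Set.mem_Iic.1 ht), neg_neg]
    · refine (integrableOn_exp_neg_Ioi 0).congr_fun (fun t ht => ?_) measurableSet_Ioi
      simp only [abs_of_pos (Set.mem_Ioi.1 ht)]
  have h2 : Integrable fun z : Fin n → ℝ => ∏ i, Real.exp (-|z i|) :=
    Integrable.fintype_prod (f := fun _ => fun t : ℝ => Real.exp (-|t|)) fun _ => h1
  have h3 := (PiLp.volume_preserving_ofLp (Fin n)).integrable_comp_of_integrable h2
  refine h3.congr (Eventually.of_forall fun z => ?_)
  simp only [Function.comp, ← Real.exp_sum, Finset.sum_neg_distrib]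

theorem integral_cexp_inner_mul_exp_neg_sum_abs {n : ℕ} (ξ : EuclideanSpace ℝ (Fin n)) :
    ∫ z : EuclideanSpace ℝ (Fin n), Complex.exp (((-2 * Real.pi * inner ℝ z ξ : ℝ) : ℂ) * Complex.I) *
      ((Real.exp (-∑ i, |z i|) : ℝ) : ℂ) = ((∏ i, 2 / (1 + (2 * Real.pi * ξ i) ^ 2) : ℝ) : ℂ) := by
  have h := integral_fintype_prod_volume_eq_prod (ι := Fin n) (E := fun _ => ℝ)
    (fun (i : Fin n) (t : ℝ) => Complex.exp (((-(2 * Real.pi * ξ i) * t : ℝ) : ℂ) * Complex.I) *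
      ((Real.exp (-|t|) : ℝ) : ℂ))
  simp only [integral_cexp_mul_exp_neg_abs] at h
  push_cast at h ⊢
  rw [← h, ← (PiLp.volume_preserving_ofLp (Fin n)).integral_comp
    (MeasurableEquiv.toLp 2 (Fin n → ℝ)).symm.measurableEmbedding]
  refine integral_congr_ae (Eventually.of_forall fun z => ?_)
  simp only [Finset.prod_mul_distrib, ← Complex.exp_sum, Finset.sum_neg_distrib]
  congr 2
  rw [← Finset.sum_mul, PiLp.inner_apply]
  push_cast
  rw [Finset.mul_sum]
  congr 1
  refine Finset.sum_congr rfl fun i _ => ?_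
  simp
  ring

/-- Lebesgue measure is the product of the Lebesgue measures of `E` and of `Eᗮ`. -/
theorem measurePreserving_add_orthogonal {n : ℕ} (E : Submodule ℝ (EuclideanSpace ℝ (Fin n))) :
    MeasurePreserving (fun q : E × Eᗮ => (q.1 : EuclideanSpace ℝ (Fin n)) + q.2) := by
  have h := E.orthogonalDecomposition.symm.measurePreserving.comp (WithLp.volume_preserving_toLp E Eᗮ)
  exact h

theorem sum_abs_add_le {n : ℕ} (x y : EuclideanSpace ℝ (Fin n)) :
    ∑ i, |(x + y) i| ≤ ∑ i, |x i| + ∑ i, |y i| := by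
  rw [← Finset.sum_add_distrib]
  exact Finset.sum_le_sum fun i _ => abs_add_le _ _

/-! ### Sections of the cross-polytope -/

theorem integral_exp_neg_sum_abs_section {n : ℕ} (E : Submodule ℝ (EuclideanSpace ℝ (Fin n))) :
    ∫ x : E, Real.exp (-∑ i, |(x : EuclideanSpace ℝ (Fin n)) i|) =
      (Module.finrank ℝ E).factorial * sectionVolume E (lpBall n 1) := by
  have h := integral_exp_neg_of_homogeneous (volume : Measure E) (p := 1) one_pos
    (φ := fun x : E => ∑ i, |(x : EuclideanSpace ℝ (Fin n)) i|) (by fun_prop)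
    (fun x => Finset.sum_nonneg fun i _ => abs_nonneg _)
    (fun r x hr => by
      have := sum_abs_rpow_smul (p := 1) hr (x : EuclideanSpace ℝ (Fin n))
      simpa using this)
  rw [h, sectionVolume_eq, div_one, add_comm, Real.Gamma_nat_eq_factorial]
  simp only [lpBall, Real.rpow_one]
  rfl

theorem integrable_exp_neg_sum_abs_section {n : ℕ} (E : Submodule ℝ (EuclideanSpace ℝ (Fin n))) :
    Integrable fun x : E => Real.exp (-∑ i, |(x : EuclideanSpace ℝ (Fin n)) i|) := by
  refine ⟨by fun_prop, ?_⟩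
  rw [hasFiniteIntegral_iff_ofReal (Eventually.of_forall fun x => (Real.exp_pos _).le)]
  rw [lintegral_exp_neg_of_homogeneous (volume : Measure E) (p := 1) one_pos
    (φ := fun x : E => ∑ i, |(x : EuclideanSpace ℝ (Fin n)) i|) (by fun_prop)
    (fun x => Finset.sum_nonneg fun i _ => abs_nonneg _)
    (fun r x hr => by
      have := sum_abs_rpow_smul (p := 1) hr (x : EuclideanSpace ℝ (Fin n))
      simpa using this)]
  refine ENNReal.mul_lt_top ENNReal.ofReal_lt_top ?_
  have := measure_section_lpBall_lt_top E one_pos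
  simpa only [lpBall, Real.rpow_one] using! this

/-- The integral of `exp (-‖·‖₁)` over the translate `E + y`, for `y` orthogonal to `E`. -/
noncomputable def fiberIntegral {n : ℕ} (E : Submodule ℝ (EuclideanSpace ℝ (Fin n))) (y : Eᗮ) : ℂ :=
  ∫ x : E, ((Real.exp (-∑ i, |((x : EuclideanSpace ℝ (Fin n)) + y) i|) : ℝ) : ℂ)

theorem integrable_fiberIntegral {n : ℕ} (E : Submodule ℝ (EuclideanSpace ℝ (Fin n))) :
    Integrable (fiberIntegral E) := by
  have h := (measurePreserving_add_orthogonal E).integrable_comp_of_integrable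
    ((integrable_exp_neg_sum_abs n).ofReal (𝕜 := ℂ))
  exact h.integral_prod_right

theorem continuousAt_fiberIntegral {n : ℕ} (E : Submodule ℝ (EuclideanSpace ℝ (Fin n))) :
    ContinuousAt (fiberIntegral E) 0 := by
  refine continuousAt_of_dominated
    (bound := fun x : E => Real.exp 1 * Real.exp (-∑ i, |(x : EuclideanSpace ℝ (Fin n)) i|)) ?_ ?_
    ((integrable_exp_neg_sum_abs_section E).const_mul _) ?_
  · exact Eventually.of_forall fun y => Continuous.aestronglyMeasurable (by fun_prop)
  · have hc : Continuous fun y : Eᗮ => ∑ i, |(y : EuclideanSpace ℝ (Fin n)) i| := by fun_prop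
    have h0 : ∀ᶠ y : Eᗮ in 𝓝 0, ∑ i, |(y : EuclideanSpace ℝ (Fin n)) i| < 1 :=
      hc.continuousAt.eventually_lt continuousAt_const (by simp)
    filter_upwards [h0] with y hy
    refine Eventually.of_forall fun x => ?_
    rw [Complex.norm_real, Real.norm_eq_abs, Real.abs_exp, ← Real.exp_add, Real.exp_le_exp]
    have h := sum_abs_add_le ((x : EuclideanSpace ℝ (Fin n)) + (y : EuclideanSpace ℝ (Fin n)))
      (-(y : EuclideanSpace ℝ (Fin n)))
    rw [add_neg_cancel_right] at h
    simp only [PiLp.neg_apply, abs_neg] at h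
    linarith
  · exact Eventually.of_forall fun x => by fun_prop

open FourierTransform in
theorem fourier_fiberIntegral {n : ℕ} (E : Submodule ℝ (EuclideanSpace ℝ (Fin n))) (ξ : Eᗮ) :
    𝓕 (fiberIntegral E) ξ =
      ((∏ i, 2 / (1 + (2 * Real.pi * (ξ : EuclideanSpace ℝ (Fin n)) i) ^ 2) : ℝ) : ℂ) := by
  rw [← integral_cexp_inner_mul_exp_neg_sum_abs, Real.fourier_eq',
    ← (measurePreserving_add_orthogonal E).map_eq,
    integral_map (measurePreserving_add_orthogonal E).aemeasurable
      (Continuous.aestronglyMeasurable (by fun_prop))]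
  have hi : Integrable (fun q : E × Eᗮ => Complex.exp (((-2 * Real.pi *
      inner ℝ ((q.1 : EuclideanSpace ℝ (Fin n)) + q.2) (ξ : EuclideanSpace ℝ (Fin n)) : ℝ) : ℂ) *
      Complex.I) * ((Real.exp (-∑ i, |((q.1 : EuclideanSpace ℝ (Fin n)) + q.2) i|) : ℝ) : ℂ)) := by
    have h := (measurePreserving_add_orthogonal E).integrable_comp_of_integrable
      ((integrable_exp_neg_sum_abs n).ofReal (𝕜 := ℂ))
    refine h.bdd_mul (c := 1) (Continuous.aestronglyMeasurable (by fun_prop))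
      (Eventually.of_forall fun q => ?_)
    rw [Complex.norm_exp_ofReal_mul_I]
  rw [Measure.volume_eq_prod, integral_prod_symm _ hi]
  refine integral_congr_ae (Eventually.of_forall fun y => ?_)
  simp only [smul_eq_mul, fiberIntegral]
  rw [← integral_const_mul]
  refine integral_congr_ae (Eventually.of_forall fun x => ?_)
  simp only
  have hx : inner ℝ (x : EuclideanSpace ℝ (Fin n)) (ξ : EuclideanSpace ℝ (Fin n)) = 0 :=
    (Submodule.mem_orthogonal _ _).1 ξ.2 _ x.2
  rw [inner_add_left, hx, zero_add, Submodule.coe_inner]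

/-- The inequality between the arithmetic and the geometric mean, applied to `1 + t i ^ 2`. -/
theorem prod_one_add_sq_le {n : ℕ} (hn : 1 ≤ n) (t : Fin n → ℝ) :
    ∏ i, (1 + t i ^ 2) ≤ (1 + (∑ i, t i ^ 2) / n) ^ n := by
  have hn' : (0 : ℝ) < n := by exact_mod_cast hn
  have h := Real.geom_mean_le_arith_mean_weighted Finset.univ (fun _ : Fin n => 1 / (n : ℝ))
    (fun i => 1 + t i ^ 2) (fun _ _ => by positivity) (by simp [hn'.ne']) (fun _ _ => by positivity)
  rw [Real.finsetProd_rpow _ _ fun i _ => by positivity] at h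
  have e : ∑ i, 1 / (n : ℝ) * (1 + t i ^ 2) = 1 + (∑ i, t i ^ 2) / n := by
    rw [← Finset.mul_sum, Finset.sum_add_distrib]
    simp
    field_simp
  rw [e] at h
  have hP : 0 ≤ ∏ i, (1 + t i ^ 2) := Finset.prod_nonneg fun i _ => by positivity
  calc ∏ i, (1 + t i ^ 2) = ((∏ i, (1 + t i ^ 2)) ^ (1 / (n : ℝ))) ^ n := by
        rw [← Real.rpow_natCast, ← Real.rpow_mul hP, one_div_mul_cancel hn'.ne', Real.rpow_one]
    _ ≤ _ := by gcongr

/-- A lower bound for sections of the cross-polytope. The density at `0` of the projection of the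
product of two-sided exponential laws to `Eᗮ` is bounded by Fourier inversion: its Fourier transform
is bounded below by a radial function, with equality when `Eᗮ` is spanned by the diagonal. -/
theorem le_sectionVolume_lpBall_one_of_fourier {n : ℕ} (hn : 1 ≤ n)
    (E : Submodule ℝ (EuclideanSpace ℝ (Fin n))) :
    2 ^ n * ((n / (4 * Real.pi)) ^ (((n : ℝ) - Module.finrank ℝ E) / 2) *
      Real.Gamma (((n : ℝ) + Module.finrank ℝ E) / 2) / Real.Gamma n) ≤
      (Module.finrank ℝ E).factorial * sectionVolume E (lpBall n 1) := by
  have hn' : (0 : ℝ) < n := by exact_mod_cast hn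
  set b : ℝ := (2 * Real.pi) ^ 2 / n with hb
  have hb0 : 0 < b := by positivity
  have hdim : (Module.finrank ℝ E : ℝ) + Module.finrank ℝ Eᗮ = n := by
    have := E.finrank_add_finrank_orthogonal
    rw [finrank_euclideanSpace_fin] at this
    exact_mod_cast this
  have hk0 : (0 : ℝ) ≤ Module.finrank ℝ E := Nat.cast_nonneg _
  have hs : (Module.finrank ℝ Eᗮ : ℝ) / 2 < n := by linarith
  have hl := lintegral_one_add_mul_norm_sq_rpow_neg (X := Eᗮ) hb0 hs
  have hm : Measurable fun w : Eᗮ => (1 + b * ‖w‖ ^ 2) ^ (-(n : ℝ)) := by fun_prop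
  have hnonneg : ∀ w : Eᗮ, 0 ≤ (1 + b * ‖w‖ ^ 2) ^ (-(n : ℝ)) := fun w => by positivity
  have hGi : Integrable fun w : Eᗮ => (1 + b * ‖w‖ ^ 2) ^ (-(n : ℝ)) := by
    refine ⟨hm.aestronglyMeasurable, ?_⟩
    rw [hasFiniteIntegral_iff_ofReal (Eventually.of_forall hnonneg), hl]
    exact ENNReal.ofReal_lt_top
  have hval : ∫ w : Eᗮ, (1 + b * ‖w‖ ^ 2) ^ (-(n : ℝ)) =
      (Real.pi / b) ^ ((Module.finrank ℝ Eᗮ : ℝ) / 2) *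
        Real.Gamma (n - (Module.finrank ℝ Eᗮ : ℝ) / 2) / Real.Gamma n := by
    have g1 := Real.Gamma_pos_of_pos hn'
    have g2 := Real.Gamma_pos_of_pos (sub_pos.2 hs)
    rw [integral_eq_lintegral_of_nonneg_ae (Eventually.of_forall hnonneg) hm.aestronglyMeasurable,
      hl, ENNReal.toReal_ofReal (by positivity)]
  have key := integral_le_re_of_le_fourier (integrable_fiberIntegral E)
    (continuousAt_fiberIntegral E) (fourier_fiberIntegral E) (hGi.const_mul (2 ^ n)) fun w => by
      rw [Finset.prod_div_distrib, Finset.prod_const, Finset.card_univ, Fintype.card_fin,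
        Real.rpow_neg (by positivity), Real.rpow_natCast, ← div_eq_mul_inv]
      refine div_le_div_of_nonneg_left (by positivity)
        (Finset.prod_pos fun i _ => by positivity) ?_
      refine (prod_one_add_sq_le hn _).trans_eq ?_
      congr 2
      rw [Submodule.coe_norm, EuclideanSpace.norm_sq_eq, hb]
      simp only [Real.norm_eq_abs, sq_abs, mul_pow, ← Finset.mul_sum]
      ring
  -- the value at `0` is the integral over `E` itself
  have h0 : (fiberIntegral E 0).re = (Module.finrank ℝ E).factorial * sectionVolume E (lpBall n 1) := by
    rw [fiberIntegral, integral_complex_ofReal, Complex.ofReal_re, ← integral_exp_neg_sum_abs_section]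
    simp
  rw [integral_const_mul, hval, h0] at key
  convert key using 3
  · congr 1
    · rw [hb]; congr 1
      · field_simp; norm_num
      · linarith
    · congr 1; linarith

/-- The section contains the Euclidean ball of radius `n ^ (-1/2)`, by the Cauchy-Schwarz inequality. -/
theorem le_sectionVolume_lpBall_one_of_ball {n : ℕ} (hn : 1 ≤ n)
    (E : Submodule ℝ (EuclideanSpace ℝ (Fin n))) (hE : 1 ≤ Module.finrank ℝ E) :
    (√n)⁻¹ ^ Module.finrank ℝ E * (√Real.pi ^ Module.finrank ℝ E /
      Real.Gamma ((Module.finrank ℝ E : ℝ) / 2 + 1)) ≤ sectionVolume E (lpBall n 1) := by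
  have hn' : (0 : ℝ) < n := by exact_mod_cast hn
  have : Nontrivial E := Module.nontrivial_of_finrank_pos (R := ℝ) hE
  have h1 : (volume : Measure E).real (Metric.closedBall 0 (√n)⁻¹) =
      (√n)⁻¹ ^ Module.finrank ℝ E * (√Real.pi ^ Module.finrank ℝ E /
      Real.Gamma ((Module.finrank ℝ E : ℝ) / 2 + 1)) := by
    have g := Real.Gamma_pos_of_pos (show 0 < (Module.finrank ℝ E : ℝ) / 2 + 1 by positivity)
    rw [measureReal_def, InnerProductSpace.volume_closedBall, ENNReal.toReal_mul, ENNReal.toReal_pow,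
      ENNReal.toReal_ofReal (by positivity), ENNReal.toReal_ofReal (by positivity)]
  rw [← h1, sectionVolume_eq]
  refine measureReal_mono ?_ (measure_section_lpBall_lt_top E one_pos).ne
  intro x hx
  rw [mem_closedBall_zero_iff, Submodule.coe_norm] at hx
  have hcs := sq_sum_le_card_mul_sum_sq (s := Finset.univ)
    (f := fun i => |(x : EuclideanSpace ℝ (Fin n)) i|)
  have e : ∑ i, |(x : EuclideanSpace ℝ (Fin n)) i| ^ 2 = ‖(x : EuclideanSpace ℝ (Fin n))‖ ^ 2 := by
    simp [EuclideanSpace.norm_sq_eq]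
  have hx2 : ‖(x : EuclideanSpace ℝ (Fin n))‖ ^ 2 ≤ (n : ℝ)⁻¹ := by
    refine (pow_le_pow_left₀ (norm_nonneg _) hx 2).trans_eq ?_
    rw [inv_pow, Real.sq_sqrt hn'.le]
  rw [e, Finset.card_univ, Fintype.card_fin] at hcs
  have h1 : (∑ i, |(x : EuclideanSpace ℝ (Fin n)) i|) ^ 2 ≤ 1 := by
    refine hcs.trans ((mul_le_mul_of_nonneg_left hx2 hn'.le).trans_eq ?_)
    field_simp
  change ∑ i, |(x : EuclideanSpace ℝ (Fin n)) i| ^ (1 : ℝ) ≤ 1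
  simp only [Real.rpow_one]
  exact (sq_le_one_iff₀ (Finset.sum_nonneg fun i _ => abs_nonneg _)).1 h1

/-- Among the sections of the cross-polytope, measured by the `k`-th root of their volume in
dimension `k`, the full ball is the smallest: its volume is `2 ^ n / n!`. -/
theorem le_sectionVolume_lpBall_one {n k : ℕ} (hk : 1 ≤ k) (hkn : k ≤ n)
    (E : Submodule ℝ (EuclideanSpace ℝ (Fin n))) (hE : Module.finrank ℝ E = k) :
    2 ^ k / (n.factorial : ℝ) ^ ((k : ℝ) / n) ≤ sectionVolume E (lpBall n 1) := by
  have hn : 1 ≤ n := hk.trans hkn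
  have hn' : (0 : ℝ) < n := by exact_mod_cast hn
  have hf : (0 : ℝ) < n.factorial := by exact_mod_cast n.factorial_pos
  rcases le_or_gt n (2 * k) with h | h
  · have hgain := fourierGain_nonneg hn h hkn
    have hbound := le_sectionVolume_lpBall_one_of_fourier hn E
    rw [hE] at hbound
    have hkf : (0 : ℝ) < k.factorial := by exact_mod_cast k.factorial_pos
    rw [← div_le_iff₀' hkf] at hbound
    refine le_trans ?_ hbound
    have g1 := Real.Gamma_pos_of_pos (show 0 < ((n : ℝ) + k) / 2 by positivity)
    have g2 := Real.Gamma_pos_of_pos hn'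
    rw [← Real.log_le_log_iff (by positivity) (by positivity)]
    rw [Real.log_div (by positivity) (by positivity), Real.log_pow, Real.log_rpow hf,
      Real.log_div (by positivity) hkf.ne', Real.log_mul (by positivity) (by positivity),
      Real.log_div (by positivity) g2.ne', Real.log_mul (by positivity) g1.ne', Real.log_pow,
      Real.log_rpow (by positivity), Real.log_div hn'.ne' (by positivity),
      Real.log_mul four_ne_zero Real.pi_ne_zero, show (4 : ℝ) = 2 ^ 2 by norm_num, Real.log_pow]
    rw [fourierGain, Real.Gamma_nat_eq_factorial, Real.log_div hn'.ne' Real.pi_ne_zero] at hgain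
    push_cast
    linarith
  · have hgain := euclideanGain_nonneg (n := n) (k := k) (by omega)
    refine le_trans ?_ (le_sectionVolume_lpBall_one_of_ball hn E (hE ▸ hk))
    rw [hE]
    have g1 := Real.Gamma_pos_of_pos (show 0 < (k : ℝ) / 2 + 1 by positivity)
    have hpi := Real.pi_pos
    rw [← Real.log_le_log_iff (by positivity) (by positivity)]
    rw [Real.log_div (by positivity) (by positivity), Real.log_pow, Real.log_rpow hf,
      Real.log_mul (by positivity) (by positivity), Real.log_div (by positivity) g1.ne', Real.log_pow,
      Real.log_pow, Real.log_inv, Real.log_sqrt hn'.le, Real.log_sqrt hpi.le]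
    rw [euclideanGain, Real.log_div Real.pi_ne_zero four_ne_zero, show (4 : ℝ) = 2 ^ 2 by norm_num,
      Real.log_pow] at hgain
    push_cast at hgain
    have e : (k : ℝ) / n * Real.log n.factorial = k * (Real.log n.factorial / n) := by ring
    rw [e]
    linarith

/-! ### Sections for `p < 1` -/

/-- The inclusion `n ^ (1 - 1/p) B_1^n ⊆ B_p^n`, an instance of the power mean inequality. -/
theorem smul_mem_lpBall {n : ℕ} (hn : 1 ≤ n) {p : ℝ} (hp : 0 < p) (hp1 : p ≤ 1)
    {x : EuclideanSpace ℝ (Fin n)} (hx : x ∈ lpBall n 1) :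
    ((n : ℝ) ^ (1 - 1 / p)) • x ∈ lpBall n p := by
  have hn' : (0 : ℝ) < n := by exact_mod_cast hn
  have hx' : ∑ i, |x i| ≤ 1 := by simpa [lpBall] using hx
  change ∑ i, |((n : ℝ) ^ (1 - 1 / p) • x) i| ^ p ≤ 1
  rw [sum_abs_rpow_smul (by positivity)]
  set S := ∑ i, |x i| ^ p
  have hS : 0 ≤ S := Finset.sum_nonneg fun i _ => Real.rpow_nonneg (abs_nonneg _) _
  have h := Real.rpow_sum_le_const_mul_sum_rpow Finset.univ (fun i => |x i| ^ p)
    (p := 1 / p) (by rw [le_div_iff₀ hp]; linarith)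
  have e : ∀ i, |(|x i| ^ p)| ^ (1 / p) = |x i| := fun i => by
    rw [abs_of_nonneg (by positivity), ← Real.rpow_mul (abs_nonneg _), mul_one_div_cancel hp.ne',
      Real.rpow_one]
  simp only [e, Finset.card_univ, Fintype.card_fin] at h
  have e2 : ∑ i, |(|x i| ^ p)| = S := Finset.sum_congr rfl fun i _ => abs_of_nonneg (by positivity)
  rw [e2] at h
  have h2 : (n : ℝ) ^ (1 - 1 / p) * S ^ (1 / p) ≤ 1 := by
    calc (n : ℝ) ^ (1 - 1 / p) * S ^ (1 / p)
        ≤ (n : ℝ) ^ (1 - 1 / p) * ((n : ℝ) ^ (1 / p - 1) * ∑ i, |x i|) := by gcongr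
      _ = ∑ i, |x i| := by
          rw [← mul_assoc, ← Real.rpow_add hn']
          simp
      _ ≤ 1 := hx'
  calc ((n : ℝ) ^ (1 - 1 / p)) ^ p * S = ((n : ℝ) ^ (1 - 1 / p) * S ^ (1 / p)) ^ p := by
        rw [Real.mul_rpow (by positivity) (by positivity), ← Real.rpow_mul hS,
          one_div_mul_cancel hp.ne', Real.rpow_one]
    _ ≤ 1 := Real.rpow_le_one (by positivity) h2 hp.le

open scoped Pointwise in
theorem le_sectionVolume_lpBall {n : ℕ} (hn : 1 ≤ n) {p : ℝ} (hp : 0 < p) (hp1 : p ≤ 1)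
    (E : Submodule ℝ (EuclideanSpace ℝ (Fin n))) :
    ((n : ℝ) ^ (1 - 1 / p)) ^ Module.finrank ℝ E * sectionVolume E (lpBall n 1) ≤
      sectionVolume E (lpBall n p) := by
  have hr : 0 < (n : ℝ) ^ (1 - 1 / p) := Real.rpow_pos_of_pos (by exact_mod_cast hn) _
  rw [sectionVolume_eq, sectionVolume_eq]
  have h := congrArg ENNReal.toReal (Measure.addHaar_smul (volume : Measure E)
    ((n : ℝ) ^ (1 - 1 / p)) {x : E | (x : EuclideanSpace ℝ (Fin n)) ∈ lpBall n 1})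
  rw [abs_of_pos (by positivity), ENNReal.toReal_mul, ENNReal.toReal_ofReal (by positivity)] at h
  rw [measureReal_def, ← h, ← measureReal_def]
  refine measureReal_mono ?_ (measure_section_lpBall_lt_top E hp).ne
  rintro _ ⟨x, hx, rfl⟩
  exact smul_mem_lpBall hn hp hp1 hx

theorem sectionConst_eq_exp {p : ℝ} (hp : 0 < p) :
    sectionConst p = Real.exp (1 - logNormGamma (1 / p)) := by
  have hx : 0 < 1 / p := by positivity
  rw [sectionConst, Gamma_one_add_eq_exp hx, mul_assoc, ← Real.mul_rpow (by positivity) hp.le]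
  have e : 1 / p / Real.exp 1 * p = Real.exp (-1) := by
    rw [Real.exp_neg]; field_simp
  rw [e, ← Real.exp_mul, ← Real.exp_add, ← Real.exp_sub]
  congr 1
  ring

theorem sectionConst_mem_Ioo {p : ℝ} (hp : 0 < p) (hp1 : p < 1) :
    sectionConst p ∈ Set.Ioo (0 : ℝ) 1 := by
  rw [sectionConst_eq_exp hp]
  refine ⟨Real.exp_pos _, ?_⟩
  rw [Real.exp_lt_one_iff]
  have h := strictMonoOn_logNormGamma (a := 1) (b := 1 / p) (by simp) (by simpa using hp)
    (by rw [lt_div_iff₀ hp]; linarith)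
  rw [logNormGamma_one] at h
  linarith

theorem sectionConst_mul_le {n k : ℕ} (hk : 1 ≤ k) (hkn : k ≤ n) {p : ℝ} (hp : 0 < p) (hp1 : p ≤ 1)
    (E : Submodule ℝ (EuclideanSpace ℝ (Fin n))) (hE : Module.finrank ℝ E = k) :
    sectionConst p * (volume.real (lpBall n p)) ^ (1 / (n : ℝ))
      ≤ (sectionVolume E (lpBall n p)) ^ (1 / (k : ℝ)) := by
  have hn : 1 ≤ n := hk.trans hkn
  have hn' : (0 : ℝ) < n := by exact_mod_cast hn
  have hk' : (0 : ℝ) < k := by exact_mod_cast hk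
  have hf : (0 : ℝ) < n.factorial := by exact_mod_cast n.factorial_pos
  have hr : 0 < (n : ℝ) ^ (1 - 1 / p) := Real.rpow_pos_of_pos hn' _
  have h1 := le_sectionVolume_lpBall hn hp hp1 E
  have h2 := le_sectionVolume_lpBall_one hk hkn E hE
  rw [hE] at h1
  have h3 : (n : ℝ) ^ (1 - 1 / p) * (2 / (n.factorial : ℝ) ^ (1 / (n : ℝ))) ≤
      (sectionVolume E (lpBall n p)) ^ (1 / (k : ℝ)) := by
    have e : (n : ℝ) ^ (1 - 1 / p) * (2 / (n.factorial : ℝ) ^ (1 / (n : ℝ))) =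
        (((n : ℝ) ^ (1 - 1 / p)) ^ k * (2 ^ k / (n.factorial : ℝ) ^ ((k : ℝ) / n))) ^ (1 / (k : ℝ)) := by
      have e1 : (n.factorial : ℝ) ^ ((k : ℝ) / n) = ((n.factorial : ℝ) ^ (1 / (n : ℝ))) ^ k := by
        rw [← Real.rpow_natCast, ← Real.rpow_mul hf.le]
        congr 1; ring
      rw [e1, ← div_pow, ← mul_pow, one_div (k : ℝ), Real.pow_rpow_inv_natCast (by positivity) (by omega)]
    rw [e]
    refine Real.rpow_le_rpow (by positivity) (le_trans ?_ h1) (by positivity)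
    gcongr
  refine le_trans ?_ h3
  have g1 := Real.Gamma_pos_of_pos (show 0 < 1 + 1 / p by positivity)
  have g2 := Real.Gamma_pos_of_pos (show 0 < 1 + n / p by positivity)
  -- After all cancellations the claim is this inequality divided by `n`.
  have hmono : logNormGamma n ≤ logNormGamma (n / p) :=
    strictMonoOn_logNormGamma.monotoneOn (by simpa using hn') (by simp; positivity)
      (by rw [le_div_iff₀ hp]; nlinarith)
  rw [volume_real_lpBall n hp, sectionConst, ← Real.log_le_log_iff (by positivity) (by positivity)]
  rw [Real.log_mul (by positivity) (by positivity), Real.log_div (by positivity) (by positivity),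
    Real.log_mul g1.ne' (by positivity), Real.log_exp, Real.log_rpow hp, Real.log_rpow (by positivity),
    Real.log_div (by positivity) g2.ne', Real.log_pow, Real.log_mul two_ne_zero g1.ne',
    Real.log_mul (by positivity) (by positivity), Real.log_div two_ne_zero (by positivity),
    Real.log_rpow hn', Real.log_rpow hf]
  rw [logNormGamma, logNormGamma, add_comm (1 : ℝ) (n : ℝ), Real.Gamma_nat_eq_factorial,
    Real.log_div hn'.ne' hp.ne'] at hmono
  have h4 := div_le_div_of_nonneg_right hmono hn'.le
  have e1 : (Real.log n.factorial + n - n * Real.log n) / n =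
      1 / n * Real.log n.factorial + 1 - Real.log n := by field_simp
  have e2 : (Real.log (Real.Gamma (1 + n / p)) + n / p - n / p * (Real.log n - Real.log p)) / n =
      1 / n * Real.log (Real.Gamma (1 + n / p)) + 1 / p - 1 / p * (Real.log n - Real.log p) := by
    field_simp
  have e3 : 1 / (n : ℝ) * (n * (Real.log 2 + Real.log (Real.Gamma (1 + 1 / p))) -
      Real.log (Real.Gamma (1 + n / p))) = Real.log 2 + Real.log (Real.Gamma (1 + 1 / p)) -
      1 / n * Real.log (Real.Gamma (1 + n / p)) := by
    field_simp
  rw [e1, e2] at h4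
  rw [e3]
  linarith

/-! ### Asymptotics of the constant -/

theorem tendsto_one_div_nhdsGT_zero : Tendsto (fun p : ℝ => 1 / p) (𝓝[>] 0) atTop := by
  simpa only [one_div] using tendsto_inv_nhdsGT_zero

theorem sectionConst_isEquivalent :
    sectionConst ~[𝓝[>] (0 : ℝ)] fun p => Real.exp 1 * √(p / (2 * Real.pi)) := by
  have h1 : Tendsto (fun p : ℝ => Real.exp (1 - stirlingRemainder (1 / p))) (𝓝[>] 0)
      (𝓝 (Real.exp (1 - Real.log (2 * Real.pi) / 2))) :=
    (Real.continuous_exp.tendsto _).comp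
      ((tendsto_stirlingRemainder.comp tendsto_one_div_nhdsGT_zero).const_sub 1)
  have h2 := ((isEquivalent_const_iff_tendsto (Real.exp_pos _).ne').2 h1).mul
    (IsEquivalent.refl (u := fun p : ℝ => √p))
  refine (h2.congr_left ?_).congr_right ?_
  · filter_upwards [self_mem_nhdsWithin] with p hp
    rw [Set.mem_Ioi] at hp
    rw [sectionConst_eq_exp hp, logNormGamma_eq, Pi.mul_apply, Real.sqrt_eq_rpow,
      Real.rpow_def_of_pos hp, ← Real.exp_add, one_div, Real.log_inv]
    congr 1
    ring
  · filter_upwards [self_mem_nhdsWithin] with p hp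
    rw [Set.mem_Ioi] at hp
    have hpi : 0 < 2 * Real.pi := by positivity
    rw [Pi.mul_apply, Function.const_apply, Real.sqrt_div hp.le, Real.exp_sub, Real.exp_half, Real.exp_log hpi]
    ring

/-! ### The diagonal line -/

/-- The unit vector on the diagonal. -/
noncomputable def diagonalUnit (n : ℕ) : EuclideanSpace ℝ (Fin n) :=
  (√n)⁻¹ • WithLp.toLp 2 (fun _ : Fin n => (1 : ℝ))

theorem norm_diagonalUnit {n : ℕ} (hn : 1 ≤ n) : ‖diagonalUnit n‖ = 1 := by
  have hn' : (0 : ℝ) < √n := by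
    have : (0 : ℝ) < n := by exact_mod_cast hn
    positivity
  rw [diagonalUnit, norm_smul, EuclideanSpace.norm_eq]
  simp [abs_of_pos hn', hn'.ne']

theorem diagonalLine_eq_span {n : ℕ} (hn : 1 ≤ n) :
    diagonalLine n = Submodule.span ℝ {diagonalUnit n} := by
  have hn' : (√n)⁻¹ ≠ 0 := by
    have : (0 : ℝ) < n := by exact_mod_cast hn
    positivity
  rw [diagonalLine, diagonalUnit, Submodule.span_singleton_smul_eq hn'.isUnit]

theorem finrank_diagonalLine {n : ℕ} (hn : 1 ≤ n) : Module.finrank ℝ (diagonalLine n) = 1 := by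
  rw [diagonalLine_eq_span hn]
  refine finrank_span_singleton fun h => ?_
  have := norm_diagonalUnit hn
  rw [h] at this
  simp at this

theorem sectionVolume_diagonalLine {n : ℕ} (hn : 1 ≤ n) {p : ℝ} (hp : 0 < p) :
    sectionVolume (diagonalLine n) (lpBall n p) = 2 * (n : ℝ) ^ (1 / 2 - 1 / p) := by
  have hn' : (0 : ℝ) < n := by exact_mod_cast hn
  rw [diagonalLine_eq_span hn, sectionVolume_eq, measureReal_def]
  set e := LinearIsometryEquiv.toSpanUnitSingleton (𝕜 := ℝ) (diagonalUnit n) (norm_diagonalUnit hn)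
    with he
  have h := e.measurePreserving.measure_preimage_equiv (f := e.toHomeomorph.toMeasurableEquiv)
    {x | (x : EuclideanSpace ℝ (Fin n)) ∈ lpBall n p}
  rw [← h]
  have hset : (e.toHomeomorph.toMeasurableEquiv ⁻¹'
      {x | (x : EuclideanSpace ℝ (Fin n)) ∈ lpBall n p}) =
      Set.Icc (-(n : ℝ) ^ (1 / 2 - 1 / p)) ((n : ℝ) ^ (1 / 2 - 1 / p)) := by
    ext t
    have hti : ∀ i : Fin n, |(t • diagonalUnit n) i| = |t| * (√n)⁻¹ := fun i => by
      simp [diagonalUnit, abs_mul, abs_of_nonneg]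
    have hmem : t • diagonalUnit n ∈ lpBall n p ↔ n * (|t| * (√n)⁻¹) ^ p ≤ 1 := by
      change ∑ i, |(t • diagonalUnit n) i| ^ p ≤ 1 ↔ _
      simp only [hti, Finset.sum_const, Finset.card_univ, Fintype.card_fin, nsmul_eq_mul]
    have hpow : n * (|t| * (√n)⁻¹) ^ p = (|t| * (n : ℝ) ^ (1 / p - 1 / 2)) ^ p := by
      rw [Real.mul_rpow (abs_nonneg _) (by positivity), Real.mul_rpow (abs_nonneg _) (by positivity),
        Real.sqrt_eq_rpow, ← Real.rpow_neg hn'.le, ← Real.rpow_mul hn'.le, ← Real.rpow_mul hn'.le,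
        sub_mul, one_div_mul_cancel hp.ne', Real.rpow_sub hn', Real.rpow_one, neg_mul,
        Real.rpow_neg hn'.le]
      ring
    have hle : (|t| * (n : ℝ) ^ (1 / p - 1 / 2)) ^ p ≤ 1 ↔ |t| ≤ (n : ℝ) ^ (1 / 2 - 1 / p) := by
      have h1 := Real.rpow_le_rpow_iff (x := |t| * (n : ℝ) ^ (1 / p - 1 / 2)) (by positivity)
        zero_le_one hp
      rw [Real.one_rpow] at h1
      rw [h1,
        show 1 / p - 1 / 2 = -(1 / 2 - 1 / p) by ring, Real.rpow_neg hn'.le, ← div_eq_mul_inv,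
        div_le_one (by positivity)]
    rw [Set.mem_Icc, ← abs_le, ← hle, ← hpow, ← hmem]
    exact Iff.rfl
  rw [hset, Real.volume_Icc, ENNReal.toReal_ofReal (by
    have := Real.rpow_nonneg hn'.le (1 / 2 - 1 / p); linarith)]
  ring

theorem diagonalRatio_eq {n : ℕ} (hn : 1 ≤ n) {p : ℝ} (hp : 0 < p) :
    diagonalRatio n p = (n : ℝ) ^ (1 / 2 - 1 / p) * Real.Gamma (1 + n / p) ^ (1 / (n : ℝ))
      / Real.Gamma (1 + 1 / p) := by
  have g1 := Real.Gamma_pos_of_pos (show 0 < 1 + 1 / p by positivity)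
  have g2 := Real.Gamma_pos_of_pos (show 0 < 1 + n / p by positivity)
  rw [diagonalRatio, sectionVolume_diagonalLine hn hp, volume_real_lpBall n hp,
    Real.div_rpow (by positivity) g2.le, one_div (n : ℝ),
    Real.pow_rpow_inv_natCast (by positivity) (by omega)]
  field_simp

/-- In the ratio on the diagonal all exponentially large factors of Stirling's formula cancel. -/
theorem diagonalRatio_eq_exp {n : ℕ} (hn : 1 ≤ n) {p : ℝ} (hp : 0 < p) :
    diagonalRatio n p =
      Real.exp (1 / n * stirlingRemainder (n * (1 / p)) - stirlingRemainder (1 / p)) *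
        (p ^ (1 / 2 - 1 / (2 * (n : ℝ))) * (n : ℝ) ^ (1 / 2 + 1 / (2 * (n : ℝ)))) := by
  have hn' : (0 : ℝ) < n := by exact_mod_cast hn
  have g1 := Real.Gamma_pos_of_pos (show 0 < 1 + 1 / p by positivity)
  have g2 := Real.Gamma_pos_of_pos (show 0 < 1 + n / p by positivity)
  rw [diagonalRatio_eq hn hp]
  refine Real.log_injOn_pos (Set.mem_Ioi.2 (by positivity)) (Set.mem_Ioi.2 (by positivity)) ?_
  rw [Real.log_div (by positivity) g1.ne', Real.log_mul (by positivity) (by positivity),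
    Real.log_rpow hn', Real.log_rpow g2, Real.log_mul (Real.exp_pos _).ne' (by positivity),
    Real.log_exp, Real.log_mul (by positivity) (by positivity), Real.log_rpow hp, Real.log_rpow hn',
    stirlingRemainder, stirlingRemainder, mul_one_div, add_comm 1 ((n : ℝ) / p), add_comm 1 (1 / p),
    Real.log_div hn'.ne' hp.ne', Real.log_div one_ne_zero hp.ne', Real.log_one]
  field_simp
  ring

theorem tendsto_diagonalRatio_factor {n : ℕ} (hn : 1 ≤ n) :
    Tendsto (fun p : ℝ =>
      Real.exp (1 / n * stirlingRemainder (n * (1 / p)) - stirlingRemainder (1 / p)))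
      (𝓝[>] 0) (𝓝 (1 / (2 * Real.pi) ^ (1 / 2 - 1 / (2 * (n : ℝ))))) := by
  have hn' : (0 : ℝ) < n := by exact_mod_cast hn
  have h1 := tendsto_stirlingRemainder.comp tendsto_one_div_nhdsGT_zero
  have h2 := tendsto_stirlingRemainder.comp (tendsto_one_div_nhdsGT_zero.const_mul_atTop hn')
  have h3 := (Real.continuous_exp.tendsto _).comp ((h2.const_mul (1 / (n : ℝ))).sub h1)
  have e : 1 / (2 * Real.pi) ^ (1 / 2 - 1 / (2 * (n : ℝ))) =
      Real.exp (1 / n * (Real.log (2 * Real.pi) / 2) - Real.log (2 * Real.pi) / 2) := by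
    rw [Real.rpow_def_of_pos (by positivity), one_div, ← Real.exp_neg]
    congr 1
    field_simp
    ring
  rw [e]
  exact h3

theorem diagonalRatio_isEquivalent {n : ℕ} (hn : 1 ≤ n) :
    diagonalRatio n ~[𝓝[>] (0 : ℝ)]
      fun p => p ^ (1 / 2 - 1 / (2 * (n : ℝ))) * (n : ℝ) ^ (1 / 2 + 1 / (2 * (n : ℝ)))
        / (2 * Real.pi) ^ (1 / 2 - 1 / (2 * (n : ℝ))) := by
  have h := ((isEquivalent_const_iff_tendsto (by positivity)).2 (tendsto_diagonalRatio_factor hn)).mul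
    (IsEquivalent.refl (u := fun p : ℝ =>
      p ^ (1 / 2 - 1 / (2 * (n : ℝ))) * (n : ℝ) ^ (1 / 2 + 1 / (2 * (n : ℝ)))))
  refine (h.congr_left ?_).congr_right (Eventually.of_forall fun p => ?_)
  · filter_upwards [self_mem_nhdsWithin] with p hp
    exact (diagonalRatio_eq_exp hn hp).symm
  · simp only [Pi.mul_apply, Function.const_apply]
    ring

theorem eventually_diagonalRatio_lt {a : ℝ} {n : ℕ} (hn : 1 ≤ n) (ha : a < 1 / 2 - 1 / (2 * (n : ℝ)))
    {C : ℝ} (hC : 0 < C) : ∀ᶠ p in 𝓝[>] (0 : ℝ), diagonalRatio n p < C * p ^ a := by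
  set s : ℝ := 1 / 2 - 1 / (2 * (n : ℝ))
  have h1 : Tendsto (fun p : ℝ => p ^ (s - a)) (𝓝[>] 0) (𝓝 0) := by
    have h := (Real.continuousAt_rpow_const 0 (s - a) (Or.inr (by linarith))).tendsto
    rw [Real.zero_rpow (by linarith)] at h
    exact h.mono_left nhdsWithin_le_nhds
  have h2 := ((tendsto_diagonalRatio_factor hn).mul_const
    ((n : ℝ) ^ (1 / 2 + 1 / (2 * (n : ℝ))))).mul h1
  rw [mul_zero] at h2
  filter_upwards [h2.eventually_lt_const hC, self_mem_nhdsWithin] with p hlt hp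
  rw [Set.mem_Ioi] at hp
  have hpa : 0 < p ^ a := Real.rpow_pos_of_pos hp a
  have hps : p ^ s = p ^ (s - a) * p ^ a := by
    rw [← Real.rpow_add hp]; ring_nf
  rw [diagonalRatio_eq_exp hn hp, hps]
  calc _ = _ := by ring
    _ < C * p ^ a := mul_lt_mul_of_pos_right hlt hpa

theorem propositionT :
    -- the constant lies in `(0, 1)`, and the lower bound holds for all sections
    (∀ p : ℝ, 0 < p → p < 1 →
      sectionConst p ∈ Set.Ioo (0 : ℝ) 1 ∧
      ∀ n k : ℕ, 1 ≤ k → k ≤ n →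
        ∀ E : Submodule ℝ (EuclideanSpace ℝ (Fin n)), Module.finrank ℝ E = k →
          sectionConst p * (volume.real (lpBall n p)) ^ (1 / (n : ℝ))
            ≤ (sectionVolume E (lpBall n p)) ^ (1 / (k : ℝ))) ∧
    -- the size of the constant as `p → 0⁺`
    (sectionConst ~[𝓝[>] (0 : ℝ)]
      fun p => Real.exp 1 * Real.sqrt (p / (2 * Real.pi))) ∧
    -- the diagonal line: exact ratio, and its size as `p → 0⁺` for fixed `n`
    (∀ n : ℕ, 1 ≤ n →
      Module.finrank ℝ (diagonalLine n) = 1 ∧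
      (∀ p : ℝ, 0 < p → p < 1 →
        diagonalRatio n p =
          (n : ℝ) ^ (1 / 2 - 1 / p) * Real.Gamma (1 + n / p) ^ (1 / (n : ℝ))
            / Real.Gamma (1 + 1 / p)) ∧
      (diagonalRatio n ~[𝓝[>] (0 : ℝ)]
        fun p => p ^ (1 / 2 - 1 / (2 * (n : ℝ))) * (n : ℝ) ^ (1 / 2 + 1 / (2 * (n : ℝ)))
          / (2 * Real.pi) ^ (1 / 2 - 1 / (2 * (n : ℝ))))) ∧
    -- the order `p ^ (1 / 2)` cannot be improved to any `p ^ a` with `a < 1 / 2`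
    (∀ a : ℝ, a < 1 / 2 → ∀ C : ℝ, 0 < C →
      ∃ N : ℕ, ∀ n : ℕ, N ≤ n → ∀ᶠ p in 𝓝[>] (0 : ℝ), diagonalRatio n p < C * p ^ a) := by
  refine ⟨fun p hp hp1 => ⟨sectionConst_mem_Ioo hp hp1, fun n k hk hkn E hE =>
    sectionConst_mul_le hk hkn hp hp1.le E hE⟩, sectionConst_isEquivalent, fun n hn =>
    ⟨finrank_diagonalLine hn, fun p hp _ => diagonalRatio_eq hn hp, diagonalRatio_isEquivalent hn⟩,
    fun a ha C hC => ?_⟩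
  -- `n > 1 / (1 - 2a)` makes the exponent `1/2 - 1/(2n)` larger than `a`.
  obtain ⟨N, hN⟩ := exists_nat_gt (1 / (1 - 2 * a))
  have hN0 : (0 : ℝ) < N := lt_trans (one_div_pos.2 (by linarith)) hN
  refine ⟨N, fun n hn => ?_⟩
  have hNn : (N : ℝ) ≤ n := by exact_mod_cast hn
  have hn0 : (0 : ℝ) < n := by linarith
  refine eventually_diagonalRatio_lt (by exact_mod_cast hn0) ?_ hC
  rw [div_lt_iff₀ (by linarith)] at hN
  have : 1 / (2 * (n : ℝ)) < 1 / 2 - a := by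
    rw [div_lt_iff₀ (by linarith)]
    nlinarith
  linarith
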